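/- **Theorem (Hypothesis Space Recovery).** *Setting.* Let $\mathcal X\subset\mathbb R^{d_0}$ be compact, and let $k_j(x,x')=\phi_j(x)^T\phi_j(x')$, $1\le j\le p$, be base kernels with continuous feature maps $\phi_j:\mathcal X\to\mathbb R^{d_j}$ and $k_j(x,x')\le 1$ for all $x,x'$; put $d_{\max}=\max_j d_j$ and $d=\sum_j d_j$. Let $k^*=\sum_j\eta_j^*k_j$ with $\eta^*\ge 0$, $\|\eta^*\|_1\le 1$, and $J_{k^*}=\{j:\eta_j^*\ne 0\}$. For a positive semidefinite kernel $k$, $\mathcal H_k$ denotes its reproducing kernel Hilbert space and $\|\cdot\|_k$ the norm of $\mathcal H_k$. *Data.* There are $m\ge1$ tasks with $n\ge1$ observations each, $y_{s,i}=f_s(x_{s,i})+\varepsilon_{s,i}$, where $f_s(x)=\sum_j\sqrt{\eta_j^*}\,\phi_j(x)^T\beta_s^{*(j)}$ (so $f_s\in\mathcal H_{k^*}$), and the $\varepsilon_{s,i}$ are i.i.d. zero-mean sub-Gaussian with variance proxy $\sigma^2>0$. The points $x_{s,i}\in\mathcal X$ are chosen by an arbitrary non-anticipating policy: the observations are made one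 per round in some order, $x_{s,i}$ depends only on the information available before its round, and $\varepsilon_{s,i}$ is independent of that information. Write $\theta^{*(j)}=(\sqrt{\eta_j^*}\,\beta_s^{*(j)})_{s\le m}\in\mathbb R^{md_j}$, and let $\Phi$ be the block-diagonal $mn\times md$ matrix whose block $s$ has the rows $(\phi_1(x_{s,i})^T,\dots,\phi_p(x_{s,i})^T)$, $i\le n$, so that $y=\Phi\theta^*+\varepsilon$. For $b\in\mathbb R^{md}$ let $b^{(j)}\in\mathbb R^{md_j}$ be the group of the coefficients that belong to $\phi_j$, over all tasks, and $b_J=(b^{(j)})_{j\in J}$. *Learned kernel.* Let $(\hat\eta,\hat f_1,\dots,\hat f_m)$ be a solution of Meta-KeL, $$\min\ \frac1m\sum_{s=1}^m\frac1n\sum_{i=1}^n\big(y_{s,i}-f_s(x_{s,i})\big)^2+\frac\lambda2\sum_{s=1}^m\|f_s\|_k^2+\frac\lambda2\|\eta\|_1\quad\text{over }\eta\ge0,\ f_s\in\mathcal H_k,\ k=\sum_j\eta_jk_j,$$ or let $\hat\eta_j=\|\hat\beta^{(j)}\|_2$ for a solution $\hat\beta$ of the group Lasso $\min_{\beta\in\mathbb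 R^{md}}\frac1{mn}\|y-\Phi\beta\|_2^2+\lambda\sum_j\|\beta^{(j)}\|_2$. With $c_1$ as below, put $\hat k=\sum_j(\hat\eta_j/c_1)\,k_j$. *Assumptions.* (Group beta-min) $c_1>0$ and $\|\theta^{*(j)}\|_2\ge c_1$ for all $j\in J_{k^*}$. (Relaxed sufficient exploration) $\kappa=\kappa(s)>0$ and, almost surely, $\|\Phi b\|_2\ge\kappa\sqrt{mn}\,\|b_J\|_2$ for all $J\subseteq\{1,\dots,p\}$ with $|J|\le s$ and all $b\ne0$ with $\sum_{j\notin J}\|b^{(j)}\|_2\le3\sum_{j\in J}\|b^{(j)}\|_2$. (Sparsity) $|J_{k^*}|\le s$. *Constants.* For $0<\delta\le1$ let $$\lambda_0=\frac{4\sigma}{\sqrt{mn}}\sqrt{1+\frac2m\Big(\log\frac{2p}\delta+\sqrt{m\,d_{\max}\log\frac{2p}\delta}\Big)},\qquad \epsilon(n,m)=\frac{32\sigma s}{\kappa^2\sqrt{mn}}\sqrt{1+\frac2m\Big(\log\frac{2p}\delta+\sqrt{m\,d_{\max}\log\frac{2p}\delta}\Big)},$$ let $\lambda\ge\lambda_0$,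 and put $\epsilon=\frac{\lambda}{\lambda_0}\,\epsilon(n,m)$, so that $\epsilon=\epsilon(n,m)$ for the choice $\lambda=\lambda_0$. *Conclusion.* If $\epsilon\le c_1$, then with probability greater than $1-\delta$, for every $\hat\eta$ as above: $\mathcal H_{k^*}\subseteq\mathcal H_{\hat k}$, and for all $f\in\mathcal H_{k^*}$ $$\|f\|_{\hat k}\le\|f\|_{k^*}\Big(1+\frac{\epsilon}{2c_1}+o(\epsilon)\Big),$$ where $o(\epsilon)=r(\epsilon)$ for a function $r$ that depends only on $c_1$, with $r(t)/t\to0$ as $t\downarrow0$. -/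

import Mathlib

open MeasureTheory ProbabilityTheory Filter Topology Asymptotics

noncomputable section

namespace MetaKeL

/-! ### Reproducing kernel Hilbert spaces of real kernels -/

/-- A real kernel `k : X → X → ℝ`, as the operator-valued kernel of the library: `k x y` acts on `ℝ`
by multiplication. -/
def kernelMatrix {X : Type*} (k : X → X → ℝ) : Matrix X X (ℝ →L[ℝ] ℝ) :=
  Matrix.of fun x y => k x y • ContinuousLinearMap.id ℝ ℝ

/-- The functions that belong to the reproducing kernel Hilbert space `H_k` of the positive
semidefinite kernel `k` (no function at all if `k` is not positive semidefinite). -/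
def rkhs {X : Type*} (k : X → X → ℝ) : Set (X → ℝ) :=
  {f | ∃ h : (kernelMatrix k).PosSemidef, haveI := Fact.mk h
    ∃ F : RKHS.OfKernel (kernelMatrix k), (⇑F : X → ℝ) = f}

/-- The norm `‖f‖_k` of `f ∈ H_k`. An element of `H_k` is determined by its values, so that the set
below has exactly one element when `f ∈ H_k`. -/
def rkhsNorm {X : Type*} (k : X → X → ℝ) (f : X → ℝ) : ℝ :=
  sInf {c : ℝ | ∃ h : (kernelMatrix k).PosSemidef, haveI := Fact.mk h
    ∃ F : RKHS.OfKernel (kernelMatrix k), (⇑F : X → ℝ) = f ∧ c = ‖F‖}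

/-! ### Base kernels and their nonnegative combinations -/

/-- The base kernel `k_j(x, x') = φ_j(x)ᵀ φ_j(x')`. -/
def baseKernel {X : Type*} {p : ℕ} {d : Fin p → ℕ} (φ : (j : Fin p) → X → EuclideanSpace ℝ (Fin (d j)))
    (j : Fin p) (x x' : X) : ℝ :=
  inner ℝ (φ j x) (φ j x')

/-- The combination `∑ j, w_j k_j`. -/
def combKernel {X : Type*} {p : ℕ} {d : Fin p → ℕ} (φ : (j : Fin p) → X → EuclideanSpace ℝ (Fin (d j)))
    (w : Fin p → ℝ) (x x' : X) : ℝ :=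
  ∑ j, w j * baseKernel φ j x x'

/-- `J_k = {j : w_j ≠ 0}`, the base kernels that are active in `∑ j, w_j k_j`. -/
def activeSet {p : ℕ} (w : Fin p → ℝ) : Finset (Fin p) :=
  Finset.univ.filter fun j => w j ≠ 0

/-! ### Multi-task coefficient vectors, the design, and the restricted eigenvalue condition -/

/-- Multi-task coefficient vectors `b ∈ ℝ^{md}`, `d = ∑ j, d_j`; the block `b s j ∈ ℝ^{d_j}` belongs to
the task `s` and the base kernel `j`. -/
abbrev Coeff (m : ℕ) {p : ℕ} (d : Fin p → ℕ) : Type :=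
  (_ : Fin m) → (j : Fin p) → EuclideanSpace ℝ (Fin (d j))

/-- The Euclidean norm of the group `b^{(j)} = (b_1^{(j)}, …, b_m^{(j)}) ∈ ℝ^{m d_j}`. -/
def groupNorm {m p : ℕ} {d : Fin p → ℕ} (b : Coeff m d) (j : Fin p) : ℝ :=
  √(∑ s, ‖b s j‖ ^ 2)

/-- The Euclidean norm of `b_J = (b^{(j)})_{j ∈ J}`. -/
def subNorm {m p : ℕ} {d : Fin p → ℕ} (b : Coeff m d) (J : Finset (Fin p)) : ℝ :=
  √(∑ j ∈ J, groupNorm b j ^ 2)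

/-- The entry `(s, i)` of `Φ b`, where `Φ` is the block-diagonal `mn × md` matrix whose block `s` has
the rows `(φ_1(x_{s,i})ᵀ, …, φ_p(x_{s,i})ᵀ)`, `i = 1, …, n`. -/
def design {X : Type*} {m n p : ℕ} {d : Fin p → ℕ}
    (φ : (j : Fin p) → X → EuclideanSpace ℝ (Fin (d j)))
    (x : Fin m → Fin n → X) (b : Coeff m d) (s : Fin m) (i : Fin n) : ℝ :=
  ∑ j, inner ℝ (φ j (x s i)) (b s j)

/-- The Euclidean norm of `Φ b ∈ ℝ^{mn}`. -/
def designNorm {X : Type*} {m n p : ℕ} {d : Fin p → ℕ}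
    (φ : (j : Fin p) → X → EuclideanSpace ℝ (Fin (d j)))
    (x : Fin m → Fin n → X) (b : Coeff m d) : ℝ :=
  √(∑ s, ∑ i, design φ x b s i ^ 2)

/-- Relaxed sufficient exploration (restricted eigenvalue condition) with the constant `κ` at the
sparsity level `S`. -/
def RelaxedSufficientExploration {X : Type*} {m n p : ℕ} {d : Fin p → ℕ}
    (φ : (j : Fin p) → X → EuclideanSpace ℝ (Fin (d j)))
    (x : Fin m → Fin n → X) (S : ℕ) (κ : ℝ) : Prop :=
  ∀ (J : Finset (Fin p)) (b : Coeff m d), J.card ≤ S → b ≠ 0 →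
    ∑ j ∈ Jᶜ, groupNorm b j ≤ 3 * ∑ j ∈ J, groupNorm b j →
    κ * (√((m : ℝ) * n) * subNorm b J) ≤ designNorm φ x b

/-! ### Meta-KeL -/

/-- The objective of Meta-KeL at the weights `w` and the task functions `f_1, …, f_m`. -/
def metaKeLObjective {X : Type*} {m n p : ℕ} {d : Fin p → ℕ}
    (φ : (j : Fin p) → X → EuclideanSpace ℝ (Fin (d j)))
    (x : Fin m → Fin n → X) (y : Fin m → Fin n → ℝ) (lam : ℝ)
    (w : Fin p → ℝ) (f : Fin m → X → ℝ) : ℝ :=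
  1 / (m : ℝ) * ∑ s, (1 / (n : ℝ) * ∑ i, (y s i - f s (x s i)) ^ 2)
    + lam / 2 * ∑ s, rkhsNorm (combKernel φ w) (f s) ^ 2
    + lam / 2 * ∑ j, |w j|

/-- The constraints of Meta-KeL: `w ≥ 0` and `f_s ∈ H_k` for all `s`, with `k = ∑ j, w_j k_j`. -/
def MetaKeLFeasible {X : Type*} {m p : ℕ} {d : Fin p → ℕ}
    (φ : (j : Fin p) → X → EuclideanSpace ℝ (Fin (d j)))
    (w : Fin p → ℝ) (f : Fin m → X → ℝ) : Prop :=
  (∀ j, 0 ≤ w j) ∧ ∀ s, f s ∈ rkhs (combKernel φ w)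

/-- `(w, f_1, …, f_m)` is a solution of Meta-KeL for the data `(x_{s,i}, y_{s,i})`. -/
def IsMetaKeLSolution {X : Type*} {m n p : ℕ} {d : Fin p → ℕ}
    (φ : (j : Fin p) → X → EuclideanSpace ℝ (Fin (d j)))
    (x : Fin m → Fin n → X) (y : Fin m → Fin n → ℝ) (lam : ℝ)
    (w : Fin p → ℝ) (f : Fin m → X → ℝ) : Prop :=
  MetaKeLFeasible φ w f ∧ ∀ (w' : Fin p → ℝ) (f' : Fin m → X → ℝ), MetaKeLFeasible φ w' f' →
    metaKeLObjective φ x y lam w f ≤ metaKeLObjective φ x y lam w' f'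

/-- The group Lasso objective `‖y - Φ b‖₂² / (mn) + λ ∑ j, ‖b^{(j)}‖₂`. -/
def groupLassoObjective {X : Type*} {m n p : ℕ} {d : Fin p → ℕ}
    (φ : (j : Fin p) → X → EuclideanSpace ℝ (Fin (d j)))
    (x : Fin m → Fin n → X) (y : Fin m → Fin n → ℝ) (lam : ℝ) (b : Coeff m d) : ℝ :=
  1 / ((m : ℝ) * n) * ∑ s, ∑ i, (y s i - design φ x b s i) ^ 2 + lam * ∑ j, groupNorm b j

/-- `b` is a minimizer of the group Lasso objective. -/
def IsGroupLassoSolution {X : Type*} {m n p : ℕ} {d : Fin p → ℕ}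
    (φ : (j : Fin p) → X → EuclideanSpace ℝ (Fin (d j)))
    (x : Fin m → Fin n → X) (y : Fin m → Fin n → ℝ) (lam : ℝ) (b : Coeff m d) : Prop :=
  ∀ b' : Coeff m d, groupLassoObjective φ x y lam b ≤ groupLassoObjective φ x y lam b'

/-! ### Noise and data collection -/

/-- The noise variables are independent, identically distributed and sub-Gaussian with variance proxy
`σ²`, i.e. `E exp (t ε) ≤ exp (σ² t² / 2)` for all real `t`; this forces mean zero. -/
structure IsSubgaussianNoise {Ω : Type*} [MeasurableSpace Ω] (μ : Measure Ω) {m n : ℕ}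
    (noise : Fin m → Fin n → Ω → ℝ) (σ : ℝ) : Prop where
  indep : iIndepFun (fun q : Fin m × Fin n => noise q.1 q.2) μ
  identDistrib : ∀ s i s' i', IdentDistrib (noise s i) (noise s' i') μ μ
  subgaussian : ∀ s i, HasSubgaussianMGF (noise s i) (σ ^ 2).toNNReal μ

/-- The data are collected without anticipation. The observation `(s, i)` is made in the round `τ s i`
(one observation per round, the tasks interleaved in any order), and `𝓕 t` is the information
available before the round `t`: the point `x_{s,i}` may be chosen in any way that depends only on the
information before its round, and the noise of that round is independent of this information. -/
def IsNonanticipating {Ω : Type*} [mΩ : MeasurableSpace Ω] (μ : Measure Ω) {X : Type*}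
    [MeasurableSpace X] {m n : ℕ} (x : Fin m → Fin n → Ω → X) (noise : Fin m → Fin n → Ω → ℝ) : Prop :=
  ∃ (𝓕 : Filtration ℕ mΩ) (τ : Fin m → Fin n → ℕ),
    Function.Injective (fun q : Fin m × Fin n => τ q.1 q.2) ∧
    (∀ s i, Measurable[𝓕 (τ s i)] (x s i)) ∧
    (∀ s i, Measurable[𝓕 (τ s i + 1)] (noise s i)) ∧
    (∀ s i, Indep (MeasurableSpace.comap (noise s i) inferInstance) (𝓕 (τ s i)) μ)

/-! ### The explicit constants -/

/-- `√(1 + (2/m) (log (2p/δ) + √(m D log (2p/δ))))`, with `D` the largest feature dimension. -/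
def noiseFactor (m p D : ℕ) (δ : ℝ) : ℝ :=
  √(1 + 2 / (m : ℝ) * (Real.log (2 * p / δ) + √((m : ℝ) * D * Real.log (2 * p / δ))))

/-- The lower threshold `λ₀` for the regularization parameter. -/
def lambdaThreshold (σ : ℝ) (m n p D : ℕ) (δ : ℝ) : ℝ :=
  4 * σ / √((m : ℝ) * n) * noiseFactor m p D δ

/-- The recovery error `ε(n, m)`. -/
def recoveryError (σ κ : ℝ) (S m n p D : ℕ) (δ : ℝ) : ℝ :=
  32 * σ * S / (κ ^ 2 * √((m : ℝ) * n)) * noiseFactor m p D δ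

end MetaKeL

end

/-!
Why the theorem holds.

*Meta-KeL is a group Lasso.* The Hilbert space of `∑ j, w_j k_j` consists of the functions
`∑ j, ⟨φ_j, θ_j⟩` with `θ_j = 0` where `w_j = 0`, and its squared norm is the least value of
`∑ j, ‖θ_j‖² / w_j` (`mem_rkhs_combKernel`, `exists_coeff_of_mem_rkhs_combKernel`). Minimizing
`(‖b^{(j)}‖² / w_j + w_j) / 2` over `w_j` gives `‖b^{(j)}‖`, attained at `w_j = ‖b^{(j)}‖` only. Hence
the weights of a Meta-KeL solution are the group norms of a group Lasso solution
(`exists_groupLassoSolution_of_metaKeL`), and it is enough to treat the group Lasso.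

*Noise.* The correlations `Z_s = ∑ i, ε_{s,i} φ_j(x_{s,i})` are vector martingales in the order of the
rounds. If `ε` is sub-Gaussian with variance proxy `v` and independent of `V` and `U`, `‖U‖ ≤ 1`, then
`E exp (‖V + ε U‖² / (2v(c+1))) ≤ √((c+1)/c) E exp (‖V‖² / (2vc))` in any dimension
(`lintegral_exp_norm_sq_add_le`). Applied round after round this bounds
`E exp (∑ s, ‖Z_s‖² / (2v(ρ+n)))` by `(1 + n/ρ)^{m/2}`, and Markov's inequality with the best `ρ` yields
`∑ s, ‖Z_s‖² < v n (m + 2L + 2√(mL))` up to probability `e^{-L}` (`measure_sum_norm_sq_ge_le`). For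
`L = log (2p/δ)` this is no more than what the threshold `λ₀` demands, and the union over `j` costs `δ/2`.

*Recovery.* On this event the basic inequality of the group Lasso puts the estimation error into the cone
of the restricted eigenvalue condition, so that the errors of the active groups sum up to at most
`3λS/(2κ²) = 3 err/16` (`groupLasso_error_le`). With the group beta-min condition and `η*_j ≤ 1`, the
learned weights are at least `(1 - 3 err/(16 c₁)) η*_j`, whence the inclusion of the Hilbert spaces and
the factor `(1 - 3 err/(16 c₁))^{-1/2}` for the norms (`rkhs_combKernel_mono`). Since `err ≤ c₁`, this
factor is at most `1 + err/(2c₁)`: the slack between the constants `3/16` and `1` in the error absorbs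
the terms of higher order, and the remainder can be taken to be zero.
-/

namespace MetaKeL

/-! ### The reproducing kernel Hilbert space of a feature map -/

section FeatureMap

variable {X H : Type*} [NormedAddCommGroup H] [InnerProductSpace ℝ H] {k : X → X → ℝ} {ψ : X → H}

lemma norm_sq_sum_feature (hk : ∀ x y, k x y = inner ℝ (ψ x) (ψ y)) (c : X →₀ ℝ) :
    ‖c.sum fun x a => a • ψ x‖ ^ 2 = c.sum fun x a => c.sum fun y b => a * b * k x y := by
  simp only [Finsupp.sum, ← real_inner_self_eq_norm_sq, sum_inner, inner_sum,
    real_inner_smul_left, real_inner_smul_right, hk, mul_assoc]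
  simp only [real_inner_comm]

lemma posSemidef_kernelMatrix (hk : ∀ x y, k x y = inner ℝ (ψ x) (ψ y)) :
    (kernelMatrix k).PosSemidef := by
  have hiff := (RKHS.posSemidef_tfae (K := kernelMatrix k)).out 0 2
  refine hiff.mpr ⟨?_, fun c => ?_⟩
  · ext x y
    simp [kernelMatrix, hk, real_inner_comm, ContinuousLinearMap.star_eq_adjoint,
      ContinuousLinearMap.adjoint_id]
  · have h := norm_sq_sum_feature hk c
    have : (c.sum fun x w => c.sum fun y w' => inner ℝ (kernelMatrix k y x w) w') =
        c.sum fun x a => c.sum fun y b => a * b * k x y := by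
      simp only [Finsupp.sum]
      refine Finset.sum_congr rfl fun x _ => Finset.sum_congr rfl fun y _ => ?_
      simp [kernelMatrix, hk, real_inner_comm]
      ring
    simp only [this, RCLike.re_to_real, ← h]
    positivity

lemma rkhsNorm_nonneg (f : X → ℝ) : 0 ≤ rkhsNorm k f := by
  refine Real.sInf_nonneg ?_
  rintro _ ⟨h, F, -, rfl⟩
  have := Fact.mk h
  exact norm_nonneg F

lemma rkhsNorm_coe [hK : Fact (kernelMatrix k).PosSemidef]
    (F : RKHS.OfKernel (kernelMatrix k)) : rkhsNorm k ⇑F = ‖F‖ := by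
  have : {c : ℝ | ∃ h : (kernelMatrix k).PosSemidef, haveI := Fact.mk h
      ∃ G : RKHS.OfKernel (kernelMatrix k), (⇑G : X → ℝ) = ⇑F ∧ c = ‖G‖} = {‖F‖} := by
    ext c
    constructor
    · rintro ⟨_, G, hG, rfl⟩
      rw [DFunLike.coe_injective hG]
      rfl
    · rintro rfl
      exact ⟨hK.out, F, rfl, rfl⟩
  rw [rkhsNorm, this, csInf_singleton]

/-- The isometric embedding of the Hilbert space of the kernel `k` into the feature space that maps the
section `k(·, x)` to the feature `ψ x`. -/
lemma exists_isometry_to_features [CompleteSpace H] [Fact (kernelMatrix k).PosSemidef]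
    (hk : ∀ x y, k x y = inner ℝ (ψ x) (ψ y)) :
    ∃ T : RKHS.OfKernel (kernelMatrix k) →ₗᵢ[ℝ] H,
      ∀ x, T (RKHS.kerFun (RKHS.OfKernel (kernelMatrix k)) x 1) = ψ x := by
  set K := RKHS.OfKernel (kernelMatrix k)
  set κ : X → K := fun x => RKHS.kerFun K x (1 : ℝ)
  have hκ : ∀ x y, k x y = inner ℝ (κ x) (κ y) := by
    intro x y
    have := RKHS.kernel_inner K y x 1 1
    rw [RKHS.OfKernel.kernel_ofKernel] at this
    simp only [κ, ← this]
    simp [kernelMatrix, hk, real_inner_comm]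
  set e : (X →₀ ℝ) →ₗ[ℝ] K := Finsupp.linearCombination ℝ κ
  set g : (X →₀ ℝ) →ₗ[ℝ] H := Finsupp.linearCombination ℝ ψ
  have hge : ∀ c, ‖g c‖ = ‖e c‖ := by
    intro c
    have : ‖g c‖ ^ 2 = ‖e c‖ ^ 2 := by
      simp only [g, e, Finsupp.linearCombination_apply, norm_sq_sum_feature hk,
        norm_sq_sum_feature hκ]
    exact (sq_eq_sq₀ (norm_nonneg _) (norm_nonneg _)).mp this
  have hge' : ∃ C, ∀ c, ‖g c‖ ≤ C * ‖e c‖ := ⟨1, fun c => by rw [hge, one_mul]⟩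
  have hdense : DenseRange e := by
    have h1 := RKHS.kerFun_dense (H := K)
    have h2 : (LinearMap.range e : Submodule ℝ K) =
        Submodule.span ℝ {RKHS.kerFun K x v | (x) (v)} := by
      rw [Finsupp.range_linearCombination]
      apply le_antisymm
      · apply Submodule.span_mono
        rintro _ ⟨x, rfl⟩
        exact ⟨x, 1, rfl⟩
      · rw [Submodule.span_le]
        rintro _ ⟨x, v, rfl⟩
        have : RKHS.kerFun K x v = v • κ x := by
          simp only [κ, ← map_smul, smul_eq_mul, mul_one]
        rw [this]
        exact Submodule.smul_mem _ _ (Submodule.subset_span ⟨x, rfl⟩)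
    rw [← h2] at h1
    rw [DenseRange, ← LinearMap.coe_range]
    exact (Submodule.dense_iff_topologicalClosure_eq_top).mpr h1
  refine ⟨⟨(g.extendOfNorm e).toLinearMap, fun F => ?_⟩, fun x => ?_⟩
  · refine hdense.induction (P := fun F => ‖g.extendOfNorm e F‖ = ‖F‖) ?_ ?_ F
    · rintro _ ⟨c, rfl⟩
      rw [LinearMap.extendOfNorm_eq hdense hge', hge]
    · exact isClosed_eq (by fun_prop) (by fun_prop)
  · have := LinearMap.extendOfNorm_eq hdense hge' (Finsupp.single x 1)
    simpa [e, g, κ] using this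

/-- The function `x ↦ ⟨ψ x, v⟩` belongs to the Hilbert space of the kernel `⟨ψ x, ψ y⟩`, and its norm
there is at most `‖v‖`. -/
lemma mem_rkhs_of_feature [CompleteSpace H] (hk : ∀ x y, k x y = inner ℝ (ψ x) (ψ y)) (v : H) :
    (fun x => inner ℝ (ψ x) v) ∈ rkhs k ∧ rkhsNorm k (fun x => inner ℝ (ψ x) v) ≤ ‖v‖ := by
  have h := posSemidef_kernelMatrix hk
  have := Fact.mk h
  obtain ⟨T, hT⟩ := exists_isometry_to_features hk
  set S := T.toContinuousLinearMap
  have hF : (⇑(S.adjoint v) : X → ℝ) = fun x => inner ℝ (ψ x) v := by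
    ext x
    have h1 := S.adjoint_inner_right (RKHS.kerFun (RKHS.OfKernel (kernelMatrix k)) x 1) v
    rw [RKHS.kerFun_inner] at h1
    simpa [S, hT] using h1
  refine ⟨⟨h, _, hF⟩, ?_⟩
  rw [← hF, rkhsNorm_coe]
  refine (ContinuousLinearMap.le_opNorm _ _).trans ?_
  rw [ContinuousLinearMap.adjoint.norm_map]
  exact mul_le_of_le_one_left (norm_nonneg _) T.norm_toContinuousLinearMap_le

/-- Each element of the Hilbert space of the kernel `⟨ψ x, ψ y⟩` has a coefficient vector in the feature
space that is as long as its norm. -/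
lemma exists_feature_of_mem_rkhs [CompleteSpace H] (hk : ∀ x y, k x y = inner ℝ (ψ x) (ψ y))
    {f : X → ℝ} (hf : f ∈ rkhs k) :
    ∃ v : H, (∀ x, f x = inner ℝ (ψ x) v) ∧ ‖v‖ = rkhsNorm k f := by
  obtain ⟨h, F, rfl⟩ := hf
  have := Fact.mk h
  obtain ⟨T, hT⟩ := exists_isometry_to_features hk
  refine ⟨T F, fun x => ?_, by rw [rkhsNorm_coe, T.norm_map]⟩
  rw [← hT, T.inner_map_map, RKHS.kerFun_inner]
  simp

end FeatureMap

/-! ### Combinations of the base kernels -/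

section CombKernel

variable {X : Type*} {p : ℕ} {d : Fin p → ℕ} {φ : (j : Fin p) → X → EuclideanSpace ℝ (Fin (d j))}
  {w : Fin p → ℝ}

/-- The feature map `x ↦ (√w_1 φ_1(x), …, √w_p φ_p(x))` of the kernel `∑ j, w_j k_j`. -/
noncomputable def combFeature (φ : (j : Fin p) → X → EuclideanSpace ℝ (Fin (d j))) (w : Fin p → ℝ)
    (x : X) : PiLp 2 fun j => EuclideanSpace ℝ (Fin (d j)) :=
  WithLp.toLp 2 fun j => √(w j) • φ j x

lemma inner_combFeature (x : X) (v : PiLp 2 fun j => EuclideanSpace ℝ (Fin (d j))) :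
    inner ℝ (combFeature φ w x) v = ∑ j, √(w j) * inner ℝ (φ j x) (v j) := by
  simp only [combFeature, PiLp.inner_apply (𝕜 := ℝ) (WithLp.toLp 2 _) v, real_inner_smul_left]

lemma combKernel_eq_inner (hw : ∀ j, 0 ≤ w j) (x y : X) :
    combKernel φ w x y = inner ℝ (combFeature φ w x) (combFeature φ w y) := by
  rw [inner_combFeature]
  refine Finset.sum_congr rfl fun j _ => ?_
  simp only [combFeature, real_inner_smul_right, baseKernel]
  rw [← mul_assoc, Real.mul_self_sqrt (hw j)]

/-- A function with coefficients `θ_j` on the features `φ_j` lies in the Hilbert space of `∑ j, w_j k_j`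
if `θ_j = 0` whenever `w_j = 0`, and then its squared norm is at most `∑ j, ‖θ_j‖² / w_j`, where the
terms with `w_j = 0` vanish by the convention `0 / 0 = 0`. -/
lemma mem_rkhs_combKernel (hw : ∀ j, 0 ≤ w j) (θ : (j : Fin p) → EuclideanSpace ℝ (Fin (d j)))
    (hθ : ∀ j, w j = 0 → θ j = 0) {f : X → ℝ} (hf : ∀ x, f x = ∑ j, inner ℝ (φ j x) (θ j)) :
    f ∈ rkhs (combKernel φ w) ∧ rkhsNorm (combKernel φ w) f ^ 2 ≤ ∑ j, ‖θ j‖ ^ 2 / w j := by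
  set v : PiLp 2 fun j => EuclideanSpace ℝ (Fin (d j)) := WithLp.toLp 2 fun j => (√(w j))⁻¹ • θ j
  have hfv : f = fun x => inner ℝ (combFeature φ w x) v := by
    ext x
    rw [hf, inner_combFeature]
    refine Finset.sum_congr rfl fun j _ => ?_
    rcases (hw j).eq_or_lt with h | h
    · simp [← h, hθ j h.symm]
    · have := (Real.sqrt_pos.mpr h).ne'
      simp only [v, real_inner_smul_right]
      field_simp
  obtain ⟨h1, h2⟩ := mem_rkhs_of_feature (combKernel_eq_inner (φ := φ) hw) v
  rw [← hfv] at h1 h2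
  refine ⟨h1, ?_⟩
  have h0 := rkhsNorm_nonneg (k := combKernel φ w) f
  have h3 : ‖v‖ ^ 2 = ∑ j, ‖θ j‖ ^ 2 / w j := by
    rw [PiLp.norm_sq_eq_of_L2]
    refine Finset.sum_congr rfl fun j _ => ?_
    simp only [v, norm_smul, mul_pow, norm_inv, Real.norm_eq_abs, sq_abs, inv_pow,
      Real.sq_sqrt (hw j)]
    rw [div_eq_inv_mul]
  rw [← h3]
  gcongr

/-- An element of the Hilbert space of `∑ j, w_j k_j` has coefficients `θ_j` on the features `φ_j` with
`∑ j, ‖θ_j‖² / w_j` at most its squared norm. -/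
lemma exists_coeff_of_mem_rkhs_combKernel (hw : ∀ j, 0 ≤ w j) {f : X → ℝ}
    (hf : f ∈ rkhs (combKernel φ w)) :
    ∃ θ : (j : Fin p) → EuclideanSpace ℝ (Fin (d j)), (∀ j, w j = 0 → θ j = 0) ∧
      (∀ x, f x = ∑ j, inner ℝ (φ j x) (θ j)) ∧
      ∑ j, ‖θ j‖ ^ 2 / w j ≤ rkhsNorm (combKernel φ w) f ^ 2 := by
  obtain ⟨v, hv, hvn⟩ := exists_feature_of_mem_rkhs (combKernel_eq_inner (φ := φ) hw) hf
  refine ⟨fun j => √(w j) • v j, fun j hj => by simp [hj], fun x => ?_, ?_⟩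
  · rw [hv, inner_combFeature]
    simp [real_inner_smul_right]
  · rw [← hvn, PiLp.norm_sq_eq_of_L2]
    refine Finset.sum_le_sum fun j _ => ?_
    rw [norm_smul, mul_pow, Real.norm_eq_abs, sq_abs, Real.sq_sqrt (hw j)]
    rcases (hw j).eq_or_lt with h | h
    · simp [← h]
    · rw [mul_div_cancel_left₀ _ h.ne']

/-- If `a w_j ≤ w'_j` for all `j` with `a > 0`, then the Hilbert space of `∑ j, w_j k_j` is contained in
that of `∑ j, w'_j k_j`, and the norm grows by the factor `a^{-1/2}` at most. -/
lemma rkhs_combKernel_mono {w' : Fin p → ℝ} {a : ℝ} (ha : 0 < a) (hw : ∀ j, 0 ≤ w j)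
    (hw' : ∀ j, 0 ≤ w' j) (h : ∀ j, a * w j ≤ w' j) {f : X → ℝ}
    (hf : f ∈ rkhs (combKernel φ w)) :
    f ∈ rkhs (combKernel φ w') ∧
      a * rkhsNorm (combKernel φ w') f ^ 2 ≤ rkhsNorm (combKernel φ w) f ^ 2 := by
  obtain ⟨θ, hθ0, hfθ, hθ⟩ := exists_coeff_of_mem_rkhs_combKernel hw hf
  have h0 : ∀ j, w' j = 0 → θ j = 0 := fun j hj => hθ0 j <| by
    have := h j
    rw [hj] at this
    exact le_antisymm (nonpos_of_mul_nonpos_right this ha) (hw j)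
  obtain ⟨h1, h2⟩ := mem_rkhs_combKernel hw' θ h0 hfθ
  refine ⟨h1, le_trans ?_ hθ⟩
  refine (mul_le_mul_of_nonneg_left h2 ha.le).trans ?_
  rw [Finset.mul_sum]
  refine Finset.sum_le_sum fun j _ => ?_
  rcases (hw j).eq_or_lt with h | hj
  · simp [hθ0 j h.symm]
  · have h3 : 0 < w' j := (mul_pos ha hj).trans_le (h j)
    rw [← mul_div_assoc, div_le_div_iff₀ h3 hj]
    nlinarith [h j, sq_nonneg ‖θ j‖]

end CombKernel

/-! ### The group Lasso -/

section GroupLasso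

variable {X : Type*} {m n p : ℕ} {d : Fin p → ℕ} {φ : (j : Fin p) → X → EuclideanSpace ℝ (Fin (d j))}
  {x : Fin m → Fin n → X} {y : Fin m → Fin n → ℝ} {lam : ℝ}

lemma groupNorm_nonneg (b : Coeff m d) (j : Fin p) : 0 ≤ groupNorm b j := Real.sqrt_nonneg _

lemma groupNorm_sq (b : Coeff m d) (j : Fin p) : groupNorm b j ^ 2 = ∑ s, ‖b s j‖ ^ 2 :=
  Real.sq_sqrt (Finset.sum_nonneg fun _ _ => sq_nonneg _)

lemma groupNorm_eq_norm (b : Coeff m d) (j : Fin p) :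
    groupNorm b j = ‖(WithLp.toLp 2 fun s => b s j : PiLp 2 fun _ : Fin m =>
      EuclideanSpace ℝ (Fin (d j)))‖ := by
  rw [PiLp.norm_eq_of_L2, groupNorm]

lemma groupNorm_add_le (a b : Coeff m d) (j : Fin p) :
    groupNorm (a + b) j ≤ groupNorm a j + groupNorm b j := by
  simp only [groupNorm_eq_norm]
  exact norm_add_le (WithLp.toLp 2 fun s => a s j : PiLp 2 fun _ : Fin m =>
      EuclideanSpace ℝ (Fin (d j))) (WithLp.toLp 2 fun s => b s j)

lemma groupNorm_neg (a : Coeff m d) (j : Fin p) : groupNorm (-a) j = groupNorm a j := by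
  simp [groupNorm]

lemma sum_inner_le_groupNorm_mul (a b : Coeff m d) (j : Fin p) :
    ∑ s, inner ℝ (a s j) (b s j) ≤ groupNorm a j * groupNorm b j := by
  simp only [groupNorm_eq_norm]
  have := real_inner_le_norm (WithLp.toLp 2 fun s => a s j : PiLp 2 fun _ : Fin m =>
      EuclideanSpace ℝ (Fin (d j))) (WithLp.toLp 2 fun s => b s j)
  rwa [PiLp.inner_apply] at this

lemma eq_zero_of_groupNorm_eq_zero {b : Coeff m d} {j : Fin p} (h : groupNorm b j = 0)
    (s : Fin m) : b s j = 0 := by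
  have h1 : ∑ s, ‖b s j‖ ^ 2 = 0 := by rw [← groupNorm_sq, h]; simp
  have h2 := (Finset.sum_eq_zero_iff_of_nonneg fun _ _ => sq_nonneg _).mp h1 s (Finset.mem_univ s)
  simpa using h2

/-- The vector `Φᵀ ε`, whose groups measure the correlation of the noise with the base kernels. -/
noncomputable def noiseCorrelation (φ : (j : Fin p) → X → EuclideanSpace ℝ (Fin (d j)))
    (x : Fin m → Fin n → X) (ε : Fin m → Fin n → ℝ) : Coeff m d :=
  fun s j => ∑ i, ε s i • φ j (x s i)

lemma sum_noise_mul_design (ε : Fin m → Fin n → ℝ) (b : Coeff m d) :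
    ∑ s, ∑ i, ε s i * design φ x b s i =
      ∑ j, ∑ s, inner ℝ (noiseCorrelation φ x ε s j) (b s j) := by
  rw [Finset.sum_comm (s := (Finset.univ : Finset (Fin p)))]
  refine Finset.sum_congr rfl fun s _ => ?_
  simp only [design, noiseCorrelation, sum_inner, Finset.mul_sum, real_inner_smul_left]
  exact Finset.sum_comm

lemma design_sub (a b : Coeff m d) (s : Fin m) (i : Fin n) :
    design φ x (a - b) s i = design φ x a s i - design φ x b s i := by
  simp [design, inner_sub_right]

/-- The basic inequality of the group Lasso, on the event that the noise is dominated by the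
regularization: the error `b - θ` of the estimator satisfies
`‖Φ (b - θ)‖² / (mn) + (λ/2) ∑_{j ∉ J} ‖(b - θ)^{(j)}‖ ≤ (3λ/2) ∑_{j ∈ J} ‖(b - θ)^{(j)}‖`. -/
lemma groupLasso_basic_inequality (hmn : 0 < (m : ℝ) * n) (hlam : 0 ≤ lam) {ε : Fin m → Fin n → ℝ}
    {θ b : Coeff m d} (hy : ∀ s i, y s i = design φ x θ s i + ε s i)
    (hε : ∀ j, groupNorm (noiseCorrelation φ x ε) j ≤ (m : ℝ) * n * lam / 4)
    {J : Finset (Fin p)} (hJ : ∀ j ∉ J, groupNorm θ j = 0)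
    (hb : IsGroupLassoSolution φ x y lam b) :
    designNorm φ x (b - θ) ^ 2 / ((m : ℝ) * n) + lam / 2 * ∑ j ∈ Jᶜ, groupNorm (b - θ) j ≤
      3 * lam / 2 * ∑ j ∈ J, groupNorm (b - θ) j := by
  set N : ℝ := (m : ℝ) * n
  have hD : designNorm φ x (b - θ) ^ 2 = ∑ s, ∑ i, design φ x (b - θ) s i ^ 2 :=
    Real.sq_sqrt (Finset.sum_nonneg fun _ _ => Finset.sum_nonneg fun _ _ => sq_nonneg _)
  have hopt := hb θ
  simp only [groupLassoObjective] at hopt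
  have h1 : ∑ s, ∑ i, (y s i - design φ x b s i) ^ 2 = ∑ s, ∑ i, (y s i - design φ x θ s i) ^ 2
      - 2 * ∑ s, ∑ i, ε s i * design φ x (b - θ) s i + designNorm φ x (b - θ) ^ 2 := by
    simp only [hD, Finset.mul_sum, ← Finset.sum_sub_distrib, ← Finset.sum_add_distrib]
    refine Finset.sum_congr rfl fun s _ => Finset.sum_congr rfl fun i _ => ?_
    rw [hy, design_sub]
    ring
  have h2 : ∑ s, ∑ i, ε s i * design φ x (b - θ) s i ≤
      N * lam / 4 * ∑ j, groupNorm (b - θ) j := by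
    rw [sum_noise_mul_design, Finset.mul_sum]
    refine Finset.sum_le_sum fun j _ => (sum_inner_le_groupNorm_mul _ _ j).trans ?_
    exact mul_le_mul_of_nonneg_right (hε j) (groupNorm_nonneg _ _)
  have h3 : ∑ j, groupNorm θ j - ∑ j, groupNorm b j ≤
      ∑ j ∈ J, groupNorm (b - θ) j - ∑ j ∈ Jᶜ, groupNorm (b - θ) j := by
    rw [← Finset.sum_add_sum_compl J, ← Finset.sum_add_sum_compl J fun j => groupNorm b j]
    have h4 : ∑ j ∈ J, groupNorm θ j ≤ ∑ j ∈ J, groupNorm b j + ∑ j ∈ J, groupNorm (b - θ) j := by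
      rw [← Finset.sum_add_distrib]
      refine Finset.sum_le_sum fun j _ => ?_
      have := groupNorm_add_le b (-(b - θ)) j
      rw [groupNorm_neg] at this
      simpa using this
    have h5 : ∑ j ∈ Jᶜ, groupNorm (b - θ) j ≤ ∑ j ∈ Jᶜ, groupNorm b j := by
      refine Finset.sum_le_sum fun j hj => ?_
      have := groupNorm_add_le b (-θ) j
      rw [groupNorm_neg, hJ j (Finset.mem_compl.mp hj), ← sub_eq_add_neg] at this
      simpa using this
    have h6 : ∑ j ∈ Jᶜ, groupNorm θ j = 0 :=
      Finset.sum_eq_zero fun j hj => hJ j (Finset.mem_compl.mp hj)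
    linarith
  have h4 := Finset.sum_add_sum_compl J fun j => groupNorm (b - θ) j
  rw [h1] at hopt
  have h5 : 1 / N * (2 * ∑ s, ∑ i, ε s i * design φ x (b - θ) s i) ≤
      lam / 2 * ∑ j, groupNorm (b - θ) j := by
    rw [one_div, inv_mul_le_iff₀ hmn]
    linarith
  have h6 := mul_le_mul_of_nonneg_left h3 hlam
  have h7 : designNorm φ x (b - θ) ^ 2 / N = 1 / N * designNorm φ x (b - θ) ^ 2 := by ring
  rw [← h4] at h5
  rw [h7]
  linarith

/-- The estimation error of the group Lasso on the active groups. -/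
lemma groupLasso_error_le (hmn : 0 < (m : ℝ) * n) (hlam : 0 < lam) {ε : Fin m → Fin n → ℝ}
    {θ b : Coeff m d} (hy : ∀ s i, y s i = design φ x θ s i + ε s i)
    (hε : ∀ j, groupNorm (noiseCorrelation φ x ε) j ≤ (m : ℝ) * n * lam / 4)
    {J : Finset (Fin p)} (hJ : ∀ j ∉ J, groupNorm θ j = 0) {S : ℕ} (hS : J.card ≤ S)
    {κ : ℝ} (hκ : 0 < κ) (hRSE : RelaxedSufficientExploration φ x (d := d) S κ)
    (hb : IsGroupLassoSolution φ x y lam b) :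
    ∑ j ∈ J, groupNorm (b - θ) j ≤ 3 * lam * S / (2 * κ ^ 2) := by
  have hbasic := groupLasso_basic_inequality hmn hlam.le hy hε hJ hb
  have hA0 : 0 ≤ ∑ j ∈ J, groupNorm (b - θ) j :=
    Finset.sum_nonneg fun j _ => groupNorm_nonneg _ _
  have hB0 : 0 ≤ ∑ j ∈ Jᶜ, groupNorm (b - θ) j :=
    Finset.sum_nonneg fun j _ => groupNorm_nonneg _ _
  have hD0 : 0 ≤ designNorm φ x (b - θ) ^ 2 / ((m : ℝ) * n) := by positivity
  rcases eq_or_ne (b - θ) 0 with h0 | h0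
  · have : ∑ j ∈ J, groupNorm (b - θ) j = 0 := by
      rw [h0]
      simp [groupNorm]
    rw [this]
    positivity
  have hcone : ∑ j ∈ Jᶜ, groupNorm (b - θ) j ≤ 3 * ∑ j ∈ J, groupNorm (b - θ) j := by
    have : lam * ∑ j ∈ Jᶜ, groupNorm (b - θ) j ≤ lam * (3 * ∑ j ∈ J, groupNorm (b - θ) j) := by
      linarith
    exact le_of_mul_le_mul_left this hlam
  have hre := hRSE J (b - θ) hS h0 hcone
  have hsub : subNorm (b - θ) J ^ 2 = ∑ j ∈ J, groupNorm (b - θ) j ^ 2 :=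
    Real.sq_sqrt (Finset.sum_nonneg fun _ _ => sq_nonneg _)
  have hcs : (∑ j ∈ J, groupNorm (b - θ) j) ^ 2 ≤ S * subNorm (b - θ) J ^ 2 := by
    rw [hsub]
    refine sq_sum_le_card_mul_sum_sq.trans ?_
    gcongr
  have hre2 : κ ^ 2 * subNorm (b - θ) J ^ 2 ≤ designNorm φ x (b - θ) ^ 2 / ((m : ℝ) * n) := by
    rw [le_div_iff₀ hmn]
    have h := pow_le_pow_left₀ (by unfold subNorm; positivity) hre 2
    rw [mul_pow, mul_pow, Real.sq_sqrt hmn.le] at h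
    linarith
  set A := ∑ j ∈ J, groupNorm (b - θ) j
  have h1 : κ ^ 2 * subNorm (b - θ) J ^ 2 ≤ 3 * lam / 2 * A := by
    have : 0 ≤ lam / 2 * ∑ j ∈ Jᶜ, groupNorm (b - θ) j := by positivity
    linarith
  have h2 : κ ^ 2 * A ^ 2 ≤ S * (3 * lam / 2 * A) := by
    calc κ ^ 2 * A ^ 2 ≤ κ ^ 2 * (S * subNorm (b - θ) J ^ 2) := by gcongr
      _ = S * (κ ^ 2 * subNorm (b - θ) J ^ 2) := by ring
      _ ≤ _ := by gcongr
  rcases hA0.eq_or_lt with h | h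
  · rw [← h]
    positivity
  · rw [le_div_iff₀ (by positivity)]
    have h3 : A * (A * (2 * κ ^ 2)) ≤ A * (3 * lam * S) := by linarith
    exact le_of_mul_le_mul_left h3 h

end GroupLasso

/-! ### Meta-KeL as a group Lasso -/

section MetaKeLAsGroupLasso

variable {X : Type*} {m n p : ℕ} {d : Fin p → ℕ} {φ : (j : Fin p) → X → EuclideanSpace ℝ (Fin (d j))}
  {x : Fin m → Fin n → X} {y : Fin m → Fin n → ℝ} {lam : ℝ}

lemma fit_eq (y z : Fin m → Fin n → ℝ) :
    1 / (m : ℝ) * ∑ s, (1 / (n : ℝ) * ∑ i, (y s i - z s i) ^ 2) =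
      1 / ((m : ℝ) * n) * ∑ s, ∑ i, (y s i - z s i) ^ 2 := by
  rw [← Finset.mul_sum, ← mul_assoc, one_div_mul_one_div]

lemma sum_sum_norm_sq_div (b : Coeff m d) (w : Fin p → ℝ) :
    ∑ s, ∑ j, ‖b s j‖ ^ 2 / w j = ∑ j, groupNorm b j ^ 2 / w j := by
  rw [Finset.sum_comm]
  simp only [groupNorm_sq, Finset.sum_div]

/-- Any coefficient vector `b` yields a feasible point of Meta-KeL with the weights `‖b^{(j)}‖`, at which
the objective is at most the group Lasso objective at `b`. -/
lemma exists_metaKeL_le_groupLasso (hlam : 0 ≤ lam) (b : Coeff m d) :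
    ∃ f : Fin m → X → ℝ, MetaKeLFeasible φ (groupNorm b) f ∧
      metaKeLObjective φ x y lam (groupNorm b) f ≤ groupLassoObjective φ x y lam b := by
  have key : ∀ s, _ := fun s => mem_rkhs_combKernel (φ := φ) (w := groupNorm b)
    (groupNorm_nonneg b) (b s) (fun j hj => eq_zero_of_groupNorm_eq_zero hj s)
    (f := fun z => ∑ j, inner ℝ (φ j z) (b s j)) fun z => rfl
  refine ⟨fun s z => ∑ j, inner ℝ (φ j z) (b s j),
    ⟨groupNorm_nonneg b, fun s => (key s).1⟩, ?_⟩
  have h1 : ∑ s, rkhsNorm (combKernel φ (groupNorm b)) (fun z => ∑ j, inner ℝ (φ j z) (b s j)) ^ 2 ≤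
      ∑ j, groupNorm b j := by
    refine (Finset.sum_le_sum fun s _ => (key s).2).trans ?_
    rw [sum_sum_norm_sq_div]
    refine Finset.sum_le_sum fun j _ => ?_
    rw [sq, mul_self_div_self]
  have h2 : ∑ j, |groupNorm b j| = ∑ j, groupNorm b j :=
    Finset.sum_congr rfl fun j _ => abs_of_nonneg (groupNorm_nonneg b j)
  simp only [metaKeLObjective, groupLassoObjective, h2]
  rw [fit_eq y fun s i => ∑ j, inner ℝ (φ j (x s i)) (b s j)]
  simp only [design]
  have h3 := mul_le_mul_of_nonneg_left h1 (div_nonneg hlam zero_le_two)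
  linarith

/-- The weights of a solution of Meta-KeL are the group norms of a solution of the group Lasso: for given
coefficients, the penalty `∑ j, (‖b^{(j)}‖² / w_j + w_j) / 2` is minimal for `w_j = ‖b^{(j)}‖` only. -/
lemma exists_groupLassoSolution_of_metaKeL (hlam : 0 < lam) {w : Fin p → ℝ} {f : Fin m → X → ℝ}
    (h : IsMetaKeLSolution φ x y lam w f) :
    ∃ b : Coeff m d, IsGroupLassoSolution φ x y lam b ∧ ∀ j, w j = groupNorm b j := by
  obtain ⟨⟨hw, hf⟩, hopt⟩ := h
  choose b hb0 hfb hb using fun s => exists_coeff_of_mem_rkhs_combKernel hw (hf s)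
  have hfit : ∀ s i, f s (x s i) = design φ x b s i := fun s i => hfb s (x s i)
  have hpen : ∑ j, groupNorm b j ^ 2 / w j ≤ ∑ s, rkhsNorm (combKernel φ w) (f s) ^ 2 := by
    rw [← sum_sum_norm_sq_div]
    exact Finset.sum_le_sum fun s _ => hb s
  have habs : ∑ j, |w j| = ∑ j, w j := Finset.sum_congr rfl fun j _ => abs_of_nonneg (hw j)
  have hle : ∀ b' : Coeff m d, 1 / ((m : ℝ) * n) * ∑ s, ∑ i, (y s i - design φ x b s i) ^ 2 +
      lam / 2 * ∑ j, (groupNorm b j ^ 2 / w j + w j) ≤ groupLassoObjective φ x y lam b' := by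
    intro b'
    obtain ⟨f', hf', hle⟩ := exists_metaKeL_le_groupLasso (φ := φ) (x := x) (y := y) hlam.le b'
    refine le_trans ?_ ((hopt _ f' hf').trans hle)
    simp only [metaKeLObjective, hfit, habs]
    rw [fit_eq y fun s i => design φ x b s i, Finset.sum_add_distrib]
    have := mul_le_mul_of_nonneg_left hpen (half_pos hlam).le
    linarith
  have hterm : ∀ j, groupNorm b j ^ 2 / w j + w j - 2 * groupNorm b j =
      (groupNorm b j - w j) ^ 2 / w j := by
    intro j
    rcases (hw j).eq_or_lt with h | h
    · have : groupNorm b j = 0 := by simp [groupNorm, hb0 _ j h.symm]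
      simp [← h, this]
    · field_simp
      ring
  have hterm0 : ∀ j, 0 ≤ (groupNorm b j - w j) ^ 2 / w j := fun j => div_nonneg (sq_nonneg _) (hw j)
  have hsum : ∑ j, (groupNorm b j ^ 2 / w j + w j) =
      2 * ∑ j, groupNorm b j + ∑ j, (groupNorm b j - w j) ^ 2 / w j := by
    rw [Finset.mul_sum, ← Finset.sum_add_distrib]
    exact Finset.sum_congr rfl fun j _ => by rw [← hterm]; ring
  have hsum0 : 0 ≤ ∑ j, (groupNorm b j - w j) ^ 2 / w j := Finset.sum_nonneg fun j _ => hterm0 j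
  simp only [hsum] at hle
  refine ⟨b, fun b' => ?_, fun j => ?_⟩
  · refine le_trans ?_ (hle b')
    have := mul_nonneg (half_pos hlam).le hsum0
    simp only [groupLassoObjective]
    linarith
  · have h1 := hle b
    simp only [groupLassoObjective] at h1
    have h2 : lam / 2 * ∑ j, (groupNorm b j - w j) ^ 2 / w j ≤ lam / 2 * 0 := by linarith
    have h3 := le_antisymm (le_of_mul_le_mul_left h2 (half_pos hlam)) hsum0
    have h4 := (Finset.sum_eq_zero_iff_of_nonneg fun j _ => hterm0 j).mp h3 j (Finset.mem_univ j)
    rcases (hw j).eq_or_lt with h | h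
    · simp [groupNorm, hb0 _ j h.symm, ← h]
    · rw [div_eq_zero_iff, or_iff_left h.ne', sq_eq_zero_iff, sub_eq_zero] at h4
      exact h4.symm

end MetaKeLAsGroupLasso

/-! ### Recovery of the hypothesis space -/

section Recovery

variable {X : Type*} {m n p : ℕ} {d : Fin p → ℕ} {φ : (j : Fin p) → X → EuclideanSpace ℝ (Fin (d j))}
  {x : Fin m → Fin n → X} {y : Fin m → Fin n → ℝ} {lam : ℝ}

/-- If the learned weights are at least `1 - 3t/16` on the active base kernels, with `t ≤ 1`, then the
Hilbert space of the learned kernel contains that of the true one, and the norm grows by the factor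
`1 + t/2` at most. -/
lemma rkhs_recovery_of_weights {w w' : Fin p → ℝ} (hw : ∀ j, 0 ≤ w j) (hw1 : ∑ j, |w j| ≤ 1)
    (hw' : ∀ j, 0 ≤ w' j) {t : ℝ} (ht0 : 0 ≤ t) (ht1 : t ≤ 1)
    (h : ∀ j ∈ activeSet w, 1 - 3 * t / 16 ≤ w' j) {f : X → ℝ} (hf : f ∈ rkhs (combKernel φ w)) :
    f ∈ rkhs (combKernel φ w') ∧
      rkhsNorm (combKernel φ w') f ≤ rkhsNorm (combKernel φ w) f * (1 + t / 2) := by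
  have ha : 0 < 1 - 3 * t / 16 := by linarith
  have hle : ∀ j, w j ≤ 1 := fun j => (le_abs_self _).trans <|
    (Finset.single_le_sum (f := fun j => |w j|) (fun i _ => abs_nonneg _) (Finset.mem_univ j)).trans
      hw1
  have hcomp : ∀ j, (1 - 3 * t / 16) * w j ≤ w' j := by
    intro j
    by_cases hj : w j = 0
    · simpa [hj] using hw' j
    · exact (mul_le_of_le_one_right ha.le (hle j)).trans (h j (by simp [activeSet, hj]))
  obtain ⟨h1, h2⟩ := rkhs_combKernel_mono ha hw hw' hcomp hf
  refine ⟨h1, ?_⟩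
  have h0 := rkhsNorm_nonneg (k := combKernel φ w) f
  refine le_of_sq_le_sq ?_ (by positivity)
  have h3 : 1 ≤ (1 + t / 2) ^ 2 * (1 - 3 * t / 16) := by nlinarith [mul_nonneg ht0 ht0]
  calc rkhsNorm (combKernel φ w') f ^ 2
      ≤ (1 + t / 2) ^ 2 * (1 - 3 * t / 16) * rkhsNorm (combKernel φ w') f ^ 2 :=
        le_mul_of_one_le_left (sq_nonneg _) h3
    _ ≤ (1 + t / 2) ^ 2 * rkhsNorm (combKernel φ w) f ^ 2 := by
        rw [mul_assoc]
        gcongr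
    _ = _ := by ring

/-- The group norms of a group Lasso solution, divided by the group beta-min constant `c₁`, exceed
`1 - 3 e / (16 c₁)` on the active groups, where `e = 8 λ S / κ²`. -/
lemma le_groupNorm_div_of_groupLasso (hmn : 0 < (m : ℝ) * n) (hlam : 0 < lam)
    {ε : Fin m → Fin n → ℝ} {θ b : Coeff m d} (hy : ∀ s i, y s i = design φ x θ s i + ε s i)
    (hε : ∀ j, groupNorm (noiseCorrelation φ x ε) j ≤ (m : ℝ) * n * lam / 4)
    {J : Finset (Fin p)} (hJ : ∀ j ∉ J, groupNorm θ j = 0) {S : ℕ} (hS : J.card ≤ S)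
    {κ : ℝ} (hκ : 0 < κ) (hRSE : RelaxedSufficientExploration φ x (d := d) S κ)
    (hb : IsGroupLassoSolution φ x y lam b) {c₁ : ℝ} (hc₁ : 0 < c₁)
    (hmin : ∀ j ∈ J, c₁ ≤ groupNorm θ j) {j : Fin p} (hj : j ∈ J) :
    1 - 3 * (8 * lam * S / κ ^ 2 / c₁) / 16 ≤ groupNorm b j / c₁ := by
  have h1 := groupLasso_error_le hmn hlam hy hε hJ hS hκ hRSE hb
  have h2 := (Finset.single_le_sum (f := fun j => groupNorm (b - θ) j)
    (fun i _ => groupNorm_nonneg _ _) hj).trans h1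
  have h3 := groupNorm_add_le b (-(b - θ)) j
  rw [groupNorm_neg] at h3
  have h4 : b + -(b - θ) = θ := by abel
  rw [h4] at h3
  have h5 := hmin j hj
  rw [le_div_iff₀ hc₁]
  have h6 : (1 - 3 * (8 * lam * S / κ ^ 2 / c₁) / 16) * c₁ = c₁ - 3 * lam * S / (2 * κ ^ 2) := by
    field_simp
    ring
  rw [h6]
  linarith

end Recovery

/-! ### Exponential moments of squares of sub-Gaussian variables -/

section SubGaussian

open scoped ENNReal NNReal

lemma lintegral_exp_quadratic_gaussianReal {s : ℝ} (hs : s < 1) (t : ℝ) :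
    ∫⁻ g, ENNReal.ofReal (Real.exp (s * g ^ 2 / 2 + t * g)) ∂(gaussianReal 0 1) =
      ENNReal.ofReal ((√(1 - s))⁻¹ * Real.exp (t ^ 2 / (2 * (1 - s)))) := by
  have h1 : 0 < 1 - s := by linarith
  set v : ℝ≥0 := (1 - s)⁻¹.toNNReal
  have hv : (v : ℝ) = (1 - s)⁻¹ := Real.coe_toNNReal _ (inv_nonneg.mpr h1.le)
  have hv0 : v ≠ 0 := by
    rw [← NNReal.coe_ne_zero, hv]
    positivity
  set C : ℝ := (√(1 - s))⁻¹ * Real.exp (t ^ 2 / (2 * (1 - s)))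
  have hC : 0 ≤ C := by positivity
  rw [gaussianReal_of_var_ne_zero _ one_ne_zero,
    lintegral_withDensity_eq_lintegral_mul _ (measurable_gaussianPDF _ _) (by fun_prop)]
  -- completing the square turns the integrand into a multiple of another Gaussian density
  have hpt : ∀ g : ℝ, (gaussianPDF 0 1 * fun g => ENNReal.ofReal
      (Real.exp (s * g ^ 2 / 2 + t * g))) g =
        ENNReal.ofReal C * ENNReal.ofReal (gaussianPDFReal (t / (1 - s)) v g) := by
    intro g
    rw [Pi.mul_apply, gaussianPDF, ← ENNReal.ofReal_mul (gaussianPDFReal_nonneg _ _ _),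
      ← ENNReal.ofReal_mul hC]
    congr 1
    have hsq : √(2 * Real.pi * (1 - s)⁻¹) = √(2 * Real.pi) * (√(1 - s))⁻¹ := by
      rw [Real.sqrt_mul (by positivity), Real.sqrt_inv]
    have h2 : √(1 - s) ≠ 0 := (Real.sqrt_pos.mpr h1).ne'
    have h3 : √(2 * Real.pi) ≠ 0 := (Real.sqrt_pos.mpr (by positivity)).ne'
    have hexp : Real.exp (-(g - 0) ^ 2 / (2 * (1 : ℝ≥0))) * Real.exp (s * g ^ 2 / 2 + t * g) =
        Real.exp (t ^ 2 / (2 * (1 - s))) *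
          Real.exp (-(g - t / (1 - s)) ^ 2 / (2 * (1 - s)⁻¹)) := by
      rw [← Real.exp_add, ← Real.exp_add]
      congr 1
      push_cast
      field_simp
      ring
    simp only [gaussianPDFReal, hv, hsq, C, NNReal.coe_one, mul_one] at hexp ⊢
    rw [mul_assoc, hexp]
    field_simp
  simp_rw [hpt]
  rw [lintegral_const_mul _ (by fun_prop), lintegral_gaussianPDFReal_eq_one _ hv0, mul_one]

variable {Ω : Type*} {𝓖 : MeasurableSpace Ω} [mΩ : MeasurableSpace Ω] {μ : Measure Ω} {X : Ω → ℝ} {v : ℝ≥0}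

lemma lintegral_exp_mul_le (hX : HasSubgaussianMGF X v μ) (t : ℝ) :
    ∫⁻ ω, ENNReal.ofReal (Real.exp (t * X ω)) ∂μ ≤ ENNReal.ofReal (Real.exp (v * t ^ 2 / 2)) := by
  rw [← ofReal_integral_eq_lintegral_ofReal (hX.integrable_exp_mul t)
    (ae_of_all _ fun _ => (Real.exp_pos _).le)]
  exact ENNReal.ofReal_le_ofReal (hX.mgf_le t)

/-- A sub-Gaussian variable has exponential moments of second order no larger than a centred Gaussian
variable of variance `v`: write `exp (a X² / 2)` as the mean of `exp (√a g X)` over a standard Gaussian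
`g` and exchange the integrals. -/
lemma lintegral_exp_quadratic_le [IsProbabilityMeasure μ] (hXm : Measurable X)
    (hX : HasSubgaussianMGF X v μ) {a : ℝ} (ha : 0 ≤ a) (hav : a * v < 1) (b : ℝ) :
    ∫⁻ ω, ENNReal.ofReal (Real.exp (a * X ω ^ 2 / 2 + b * X ω)) ∂μ ≤
      ENNReal.ofReal ((√(1 - a * v))⁻¹ * Real.exp (v * b ^ 2 / (2 * (1 - a * v)))) := by
  have h1 : 0 < 1 - a * v := by linarith
  have hmix : ∀ ω, ENNReal.ofReal (Real.exp (a * X ω ^ 2 / 2 + b * X ω)) =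
      ∫⁻ g, ENNReal.ofReal (Real.exp ((√a * g + b) * X ω)) ∂(gaussianReal 0 1) := by
    intro ω
    have h := lintegral_exp_quadratic_gaussianReal zero_lt_one (√a * X ω)
    calc ENNReal.ofReal (Real.exp (a * X ω ^ 2 / 2 + b * X ω))
        = ENNReal.ofReal (Real.exp (b * X ω)) *
          ∫⁻ g, ENNReal.ofReal (Real.exp (0 * g ^ 2 / 2 + √a * X ω * g)) ∂(gaussianReal 0 1) := by
          rw [h, ← ENNReal.ofReal_mul (Real.exp_pos _).le]
          congr 1
          simp only [sub_zero, Real.sqrt_one, inv_one, one_mul, mul_one, mul_pow, Real.sq_sqrt ha]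
          rw [← Real.exp_add, add_comm]
      _ = _ := by
          rw [← lintegral_const_mul _ (by fun_prop)]
          refine lintegral_congr fun g => ?_
          rw [← ENNReal.ofReal_mul (Real.exp_pos _).le, ← Real.exp_add]
          congr 2
          ring
  simp_rw [hmix]
  rw [lintegral_lintegral_swap (by fun_prop)]
  refine (lintegral_mono fun g => lintegral_exp_mul_le hX _).trans_eq ?_
  calc ∫⁻ g, ENNReal.ofReal (Real.exp (v * (√a * g + b) ^ 2 / 2)) ∂(gaussianReal 0 1)
      = ENNReal.ofReal (Real.exp (v * b ^ 2 / 2)) * ∫⁻ g, ENNReal.ofReal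
          (Real.exp (a * v * g ^ 2 / 2 + v * √a * b * g)) ∂(gaussianReal 0 1) := by
        rw [← lintegral_const_mul _ (by fun_prop)]
        refine lintegral_congr fun g => ?_
        rw [← ENNReal.ofReal_mul (Real.exp_pos _).le, ← Real.exp_add]
        congr 2
        linear_combination (v * g ^ 2 / 2) * Real.sq_sqrt ha
    _ = _ := by
        rw [lintegral_exp_quadratic_gaussianReal hav, ← ENNReal.ofReal_mul (Real.exp_pos _).le,
          mul_left_comm, ← Real.exp_add]
        congr 3
        have h2 : (v * √a * b) ^ 2 = v * b ^ 2 * (1 - (1 - a * v)) := by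
          rw [mul_pow, mul_pow, Real.sq_sqrt ha]
          ring
        rw [h2]
        set q := 1 - a * v
        field_simp
        ring

/-- The second-order exponential moment of a sub-Gaussian variable that is independent of `𝓖`, with
coefficients that are known to `𝓖`. -/
lemma lintegral_mul_exp_quadratic_le [IsProbabilityMeasure μ] (h𝓖 : 𝓖 ≤ mΩ)
    (hXm : Measurable X) (hX : HasSubgaussianMGF X v μ)
    (hind : Indep (MeasurableSpace.comap X inferInstance) 𝓖 μ)
    {W : Ω → ℝ≥0∞} {a b : Ω → ℝ} (hW : Measurable[𝓖] W) (ha : Measurable[𝓖] a)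
    (hb : Measurable[𝓖] b) (ha0 : ∀ ω, 0 ≤ a ω) (hav : ∀ ω, a ω * v < 1) :
    ∫⁻ ω, W ω * ENNReal.ofReal (Real.exp (a ω * X ω ^ 2 / 2 + b ω * X ω)) ∂μ ≤
      ∫⁻ ω, W ω * ENNReal.ofReal ((√(1 - a ω * v))⁻¹ *
        Real.exp (v * b ω ^ 2 / (2 * (1 - a ω * v)))) ∂μ := by
  set ξ : Ω → ℝ≥0∞ × ℝ × ℝ := fun ω => (W ω, a ω, b ω)
  have hξ𝓖 : Measurable[𝓖] ξ := hW.prodMk (ha.prodMk hb)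
  have hξ : Measurable ξ := hξ𝓖.mono h𝓖 le_rfl
  have hindep : IndepFun ξ X μ := by
    rw [IndepFun_iff_Indep]
    exact indep_of_indep_of_le_left hind.symm hξ𝓖.comap_le
  have hmap := (indepFun_iff_map_prod_eq_prod_map_map hξ.aemeasurable hXm.aemeasurable).mp hindep
  set F : (ℝ≥0∞ × ℝ × ℝ) × ℝ → ℝ≥0∞ := fun z =>
    z.1.1 * ENNReal.ofReal (Real.exp (z.1.2.1 * z.2 ^ 2 / 2 + z.1.2.2 * z.2))
  have hF : Measurable F := by fun_prop
  have hprob : IsProbabilityMeasure (μ.map X) := Measure.isProbabilityMeasure_map hXm.aemeasurable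
  calc ∫⁻ ω, W ω * ENNReal.ofReal (Real.exp (a ω * X ω ^ 2 / 2 + b ω * X ω)) ∂μ
      = ∫⁻ z, F z ∂(μ.map fun ω => (ξ ω, X ω)) := (lintegral_map hF (hξ.prodMk hXm)).symm
    _ = ∫⁻ ω, ∫⁻ ω', F (ξ ω, X ω') ∂μ ∂μ := by
        rw [hmap, lintegral_prod _ hF.aemeasurable, lintegral_map hF.lintegral_prod_right' hξ]
        refine lintegral_congr fun ω => ?_
        rw [lintegral_map (by fun_prop) hXm]
    _ ≤ _ := by
        refine lintegral_mono fun ω => ?_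
        simp only [F, ξ]
        rw [lintegral_const_mul _ (by fun_prop)]
        gcongr
        exact lintegral_exp_quadratic_le hXm hX (ha0 ω) (hav ω) (b ω)

variable {H : Type*} [NormedAddCommGroup H] [InnerProductSpace ℝ H] [MeasurableSpace H]
  [BorelSpace H] [SecondCountableTopology H]

/-- One step of the supermartingale: adding the noisy vector `X U` with `‖U‖ ≤ 1` to `V` and increasing
the scale from `c` to `c + 1` costs the factor `√((c + 1) / c)` at most, in any dimension. -/
lemma lintegral_exp_norm_sq_add_le [IsProbabilityMeasure μ] (h𝓖 : 𝓖 ≤ mΩ)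
    (hXm : Measurable X) (hX : HasSubgaussianMGF X v μ) (hv : 0 < v)
    (hind : Indep (MeasurableSpace.comap X inferInstance) 𝓖 μ)
    {W : Ω → ℝ≥0∞} {V U : Ω → H} (hW : Measurable[𝓖] W) (hV : Measurable[𝓖] V)
    (hU : Measurable[𝓖] U) (hU1 : ∀ ω, ‖U ω‖ ≤ 1) {c : ℝ} (hc : 0 < c) :
    ∫⁻ ω, W ω * ENNReal.ofReal (Real.exp (‖V ω + X ω • U ω‖ ^ 2 / (2 * v * (c + 1)))) ∂μ ≤
      ENNReal.ofReal (√((c + 1) / c)) *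
        ∫⁻ ω, W ω * ENNReal.ofReal (Real.exp (‖V ω‖ ^ 2 / (2 * v * c))) ∂μ := by
  have hv' : (0 : ℝ) < v := hv
  set γ : ℝ := (v * (c + 1))⁻¹
  have hγ : 0 < γ := by positivity
  have hγv : γ * v = (c + 1)⁻¹ := by
    simp only [γ]
    field_simp
  have ha1 : ∀ ω, γ * ‖U ω‖ ^ 2 * v ≤ (c + 1)⁻¹ := by
    intro ω
    rw [mul_right_comm, hγv]
    exact mul_le_of_le_one_right (by positivity) (pow_le_one₀ (norm_nonneg _) (hU1 ω))
  have hc1 : (c + 1)⁻¹ < 1 := inv_lt_one_of_one_lt₀ (by linarith)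
  have hc2 : 1 - (c + 1)⁻¹ = c / (c + 1) := by field_simp; ring
  have hWV : Measurable[𝓖] fun ω => W ω * ENNReal.ofReal (Real.exp (γ / 2 * ‖V ω‖ ^ 2)) := by
    fun_prop
  have ha : Measurable[𝓖] fun ω => γ * ‖U ω‖ ^ 2 := by fun_prop
  have hb : Measurable[𝓖] fun ω => γ * inner ℝ (V ω) (U ω) :=
    (hV.inner hU).const_mul γ
  have hWm : Measurable W := hW.mono h𝓖 le_rfl
  have hVm : Measurable V := hV.mono h𝓖 le_rfl
  rw [← lintegral_const_mul _ (by fun_prop)]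
  calc ∫⁻ ω, W ω * ENNReal.ofReal (Real.exp (‖V ω + X ω • U ω‖ ^ 2 / (2 * v * (c + 1)))) ∂μ
      = ∫⁻ ω, W ω * ENNReal.ofReal (Real.exp (γ / 2 * ‖V ω‖ ^ 2)) * ENNReal.ofReal (Real.exp
          (γ * ‖U ω‖ ^ 2 * X ω ^ 2 / 2 + γ * inner ℝ (V ω) (U ω) * X ω)) ∂μ := by
        refine lintegral_congr fun ω => ?_
        rw [mul_assoc (W ω), ← ENNReal.ofReal_mul (Real.exp_pos _).le, ← Real.exp_add]
        congr 3
        rw [norm_add_sq_real, norm_smul, mul_pow, Real.norm_eq_abs, sq_abs, inner_smul_right]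
        simp only [γ]
        field_simp
        ring
    _ ≤ _ := lintegral_mul_exp_quadratic_le h𝓖 hXm hX hind hWV ha hb (fun ω => by positivity)
        fun ω => (ha1 ω).trans_lt hc1
    _ ≤ _ := by
        refine lintegral_mono fun ω => ?_
        rw [mul_assoc, mul_left_comm (ENNReal.ofReal √_)]
        refine mul_le_mul_right ?_ (W ω)
        rw [← ENNReal.ofReal_mul (Real.exp_pos _).le, ← ENNReal.ofReal_mul (Real.sqrt_nonneg _)]
        apply ENNReal.ofReal_le_ofReal
        have h1 : c / (c + 1) ≤ 1 - γ * ‖U ω‖ ^ 2 * v := by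
          rw [← hc2]
          linarith [ha1 ω]
        have h2 : (√(1 - γ * ‖U ω‖ ^ 2 * v))⁻¹ ≤ √((c + 1) / c) := by
          rw [← Real.sqrt_inv]
          apply Real.sqrt_le_sqrt
          rw [← inv_div]
          exact inv_anti₀ (by positivity) h1
        have hcs : inner ℝ (V ω) (U ω) ^ 2 ≤ ‖V ω‖ ^ 2 := by
          rw [← sq_abs (inner ℝ (V ω) (U ω))]
          have := (abs_real_inner_le_norm (V ω) (U ω)).trans
            (mul_le_of_le_one_right (norm_nonneg _) (hU1 ω))
          gcongr
        have h3 : v * (γ * inner ℝ (V ω) (U ω)) ^ 2 / (2 * (1 - γ * ‖U ω‖ ^ 2 * v)) ≤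
            v * (γ ^ 2 * ‖V ω‖ ^ 2) / (2 * (c / (c + 1))) := by
          rw [mul_pow]
          gcongr
        rw [mul_left_comm, ← Real.exp_add]
        gcongr
        refine (add_le_add_right h3 _).trans_eq ?_
        simp only [γ]
        field_simp

end SubGaussian

/-! ### Concentration of adaptively collected noise -/

section Concentration

open scoped ENNReal NNReal

variable {Ω : Type*} [mΩ : MeasurableSpace Ω] {μ : Measure Ω} {v : ℝ≥0}
variable {H : Type*} [NormedAddCommGroup H] [InnerProductSpace ℝ H] [MeasurableSpace H]
  [BorelSpace H] [SecondCountableTopology H]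

/-- The exponential moment of the sums `∑ e_q u_q` over the observations of each task, normalized by the
number of observations made. The proof adds the observations in the order of their rounds. -/
lemma lintegral_exp_sum_norm_sq_le [IsProbabilityMeasure μ] {Q K : Type*} [DecidableEq Q]
    [Fintype K] [DecidableEq K] (task : Q → K) {e : Q → Ω → ℝ} {u : Q → Ω → H}
    {𝓕 : Filtration ℕ mΩ} {τ : Q → ℕ} (hτ : Function.Injective τ)
    (hu : ∀ q, Measurable[𝓕 (τ q)] (u q)) (he : ∀ q, Measurable[𝓕 (τ q + 1)] (e q))
    (hind : ∀ q, Indep (MeasurableSpace.comap (e q) inferInstance) (𝓕 (τ q)) μ)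
    (hsub : ∀ q, HasSubgaussianMGF (e q) v μ) (hv : 0 < v) (hu1 : ∀ q ω, ‖u q ω‖ ≤ 1)
    {ρ : ℝ} (hρ : 0 < ρ) (A : Finset Q) :
    ∫⁻ ω, ENNReal.ofReal (Real.exp (∑ s, ‖∑ q ∈ A with task q = s, e q ω • u q ω‖ ^ 2 /
        (2 * v * (ρ + (A.filter fun q => task q = s).card)))) ∂μ ≤
      ENNReal.ofReal (∏ s, √((ρ + (A.filter fun q => task q = s).card) / ρ)) := by
  induction A using Finset.induction_on_max_value τ with
  | empty => simp [hρ.ne']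
  | insert a A haA hmax ih =>
    set Z : K → Ω → H := fun s ω => ∑ q ∈ A with task q = s, e q ω • u q ω
    set N : K → ℝ := fun s => ρ + (A.filter fun q => task q = s).card
    have hNpos : ∀ s, 0 < N s := fun s => by positivity
    have hlt : ∀ q ∈ A, τ q + 1 ≤ τ a := fun q hq =>
      Nat.succ_le_of_lt <| lt_of_le_of_ne (hmax q hq) fun h => haA (hτ h ▸ hq)
    have hZ : ∀ s, Measurable[𝓕 (τ a)] (Z s) := by
      intro s
      refine Finset.measurable_sum _ fun q hq => ?_
      have hq' := hlt q (Finset.mem_filter.mp hq).1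
      exact ((he q).mono (𝓕.mono hq') le_rfl).smul
        ((hu q).mono (𝓕.mono (by omega)) le_rfl)
    set W : Ω → ℝ≥0∞ := fun ω =>
      ENNReal.ofReal (Real.exp (∑ s ∈ Finset.univ.erase (task a), ‖Z s ω‖ ^ 2 / (2 * v * N s)))
    have hW : Measurable[𝓕 (τ a)] W := by
      refine ENNReal.measurable_ofReal.comp (Real.measurable_exp.comp ?_)
      exact Finset.measurable_sum _ fun s _ =>
        (by fun_prop : Measurable fun z : H => ‖z‖ ^ 2 / (2 * v * N s)).comp (hZ s)
    have hstep := lintegral_exp_norm_sq_add_le (μ := μ) (𝓕.le (τ a))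
      ((he a).mono (𝓕.le _) le_rfl) (hsub a) hv (hind a) hW (hZ (task a)) (hu a) (hu1 a)
      (hNpos (task a))
    have hfa : (insert a A).filter (fun q => task q = task a) =
        insert a (A.filter fun q => task q = task a) := by
      rw [Finset.filter_insert, if_pos rfl]
    have hfs : ∀ s, s ≠ task a → (insert a A).filter (fun q => task q = s) =
        A.filter fun q => task q = s := by
      intro s hs
      rw [Finset.filter_insert, if_neg (Ne.symm hs)]
    have hnot : a ∉ A.filter fun q => task q = task a := fun h => haA (Finset.mem_filter.mp h).1
    have hcard : ρ + ((insert a A).filter fun q => task q = task a).card = N (task a) + 1 := by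
      rw [hfa, Finset.card_insert_of_notMem hnot]
      push_cast
      ring
    have hsplit : ∀ ω, ∑ s, ‖∑ q ∈ insert a A with task q = s, e q ω • u q ω‖ ^ 2 /
        (2 * v * (ρ + ((insert a A).filter fun q => task q = s).card)) =
          ∑ s ∈ Finset.univ.erase (task a), ‖Z s ω‖ ^ 2 / (2 * v * N s) +
            ‖Z (task a) ω + e a ω • u a ω‖ ^ 2 / (2 * v * (N (task a) + 1)) := by
      intro ω
      rw [← Finset.sum_erase_add _ _ (Finset.mem_univ (task a)), hcard, hfa,
        Finset.sum_insert hnot, add_comm (e a ω • u a ω)]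
      congr 1
      refine Finset.sum_congr rfl fun s hs => ?_
      rw [hfs s (Finset.ne_of_mem_erase hs)]
    have hprod : ∏ s, √((ρ + ((insert a A).filter fun q => task q = s).card) / ρ) =
        √((N (task a) + 1) / N (task a)) * ∏ s, √(N s / ρ) := by
      rw [← Finset.prod_erase_mul _ _ (Finset.mem_univ (task a)), hcard,
        ← Finset.prod_erase_mul Finset.univ (fun s => √(N s / ρ)) (Finset.mem_univ (task a)),
        mul_left_comm, ← Real.sqrt_mul (by have := hNpos (task a); positivity),
        div_mul_div_cancel₀ (hNpos (task a)).ne']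
      congr 1
      refine Finset.prod_congr rfl fun s hs => ?_
      rw [hfs s (Finset.ne_of_mem_erase hs)]
    rw [hprod, ENNReal.ofReal_mul (Real.sqrt_nonneg _)]
    calc _ = ∫⁻ ω, W ω * ENNReal.ofReal (Real.exp (‖Z (task a) ω + e a ω • u a ω‖ ^ 2 /
          (2 * v * (N (task a) + 1)))) ∂μ := by
          refine lintegral_congr fun ω => ?_
          rw [hsplit, Real.exp_add, ENNReal.ofReal_mul (Real.exp_pos _).le]
      _ ≤ _ := hstep
      _ ≤ _ := by
          refine mul_le_mul_right ?_ _
          refine le_trans (le_of_eq ?_) ih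
          refine lintegral_congr fun ω => ?_
          rw [← ENNReal.ofReal_mul (Real.exp_pos _).le, ← Real.exp_add,
            Finset.sum_erase_add _ _ (Finset.mem_univ (task a))]

lemma log_one_add_inv_le {r : ℝ} (hr : 0 < r) :
    (1 + r) * Real.log ((r + 1) / r) ≤ 1 + 1 / (2 * r) := by
  have hpos : 0 < (r + 1) / r := by positivity
  -- `log t ≤ sinh (log t) = (t - t⁻¹) / 2` for `t ≥ 1`
  have h := Real.self_le_sinh_iff.mpr
    (Real.log_nonneg (show 1 ≤ (r + 1) / r by rw [le_div_iff₀ hr]; linarith))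
  rw [Real.sinh_eq, Real.exp_neg, Real.exp_log hpos] at h
  calc (1 + r) * Real.log ((r + 1) / r) ≤ (1 + r) * (((r + 1) / r - ((r + 1) / r)⁻¹) / 2) := by
        gcongr
    _ = 1 + 1 / (2 * r) := by
        field_simp
        ring

/-- The choice of the scale `ρ = n r` with `r = √(m / (4 L))` in the exponential Markov inequality. -/
lemma exists_scale {m L : ℝ} (hm : 0 < m) (hL : 0 < L) :
    ∃ r : ℝ, 0 < r ∧
      m / 2 * Real.log ((r + 1) / r) - (m + 2 * L + 2 * √(m * L)) / (2 * (r + 1)) ≤ -L := by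
  have hs : 0 < √(m * L) := Real.sqrt_pos.mpr (mul_pos hm hL)
  have hsq : √(m * L) * √(m * L) = m * L := Real.mul_self_sqrt (mul_pos hm hL).le
  set q := √(m * L)
  refine ⟨q / (2 * L), by positivity, ?_⟩
  set r := q / (2 * L)
  have hr : 0 < r := by positivity
  have h1 := mul_le_mul_of_nonneg_left (log_one_add_inv_le hr) hm.le
  have h2 : m * (1 / (2 * r)) = q := by
    simp only [r]
    field_simp
    linarith
  have h3 : 2 * r * L = q := by
    simp only [r]
    field_simp
  have h4 : m / 2 * Real.log ((r + 1) / r) + L ≤ (m + 2 * L + 2 * q) / (2 * (r + 1)) := by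
    rw [le_div_iff₀ (by positivity)]
    linarith
  linarith

/-- The tail bound for the sums `Z_s = ∑ i, ε_{s,i} u_{s,i}` over the `n` observations of each of `m`
tasks: `∑ s, ‖Z_s‖² ≥ v n (m + 2 L + 2 √(m L))` has probability at most `e^{-L}`. -/
lemma measure_sum_norm_sq_ge_le [IsProbabilityMeasure μ] {m n : ℕ} (hm : 0 < m) (hn : 0 < n)
    {e : Fin m → Fin n → Ω → ℝ} {u : Fin m → Fin n → Ω → H}
    {𝓕 : Filtration ℕ mΩ} {τ : Fin m → Fin n → ℕ}
    (hτ : Function.Injective fun q : Fin m × Fin n => τ q.1 q.2)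
    (hu : ∀ s i, Measurable[𝓕 (τ s i)] (u s i)) (he : ∀ s i, Measurable[𝓕 (τ s i + 1)] (e s i))
    (hind : ∀ s i, Indep (MeasurableSpace.comap (e s i) inferInstance) (𝓕 (τ s i)) μ)
    (hsub : ∀ s i, HasSubgaussianMGF (e s i) v μ) (hv : 0 < v) (hu1 : ∀ s i ω, ‖u s i ω‖ ≤ 1)
    {L : ℝ} (hL : 0 < L) :
    μ {ω | v * n * (m + 2 * L + 2 * √(m * L)) ≤ ∑ s, ‖∑ i, e s i ω • u s i ω‖ ^ 2} ≤
      ENNReal.ofReal (Real.exp (-L)) := by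
  have hm' : (0 : ℝ) < m := Nat.cast_pos.mpr hm
  have hn' : (0 : ℝ) < n := Nat.cast_pos.mpr hn
  have hv' : (0 : ℝ) < v := hv
  obtain ⟨r, hr, hrL⟩ := exists_scale hm' hL
  have hmom := lintegral_exp_sum_norm_sq_le (μ := μ) (Prod.fst : Fin m × Fin n → Fin m) hτ
    (fun q => hu q.1 q.2) (fun q => he q.1 q.2) (fun q => hind q.1 q.2) (fun q => hsub q.1 q.2) hv
    (fun q => hu1 q.1 q.2) (mul_pos hn' hr) Finset.univ
  have hcard : ∀ s : Fin m,
      ((Finset.univ : Finset (Fin m × Fin n)).filter fun q => q.1 = s).card = n := by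
    intro s
    rw [Finset.card_filter, Fintype.sum_prod_type]
    simp [apply_ite Finset.card]
  have hsum : ∀ (s : Fin m) (ω : Ω), ∑ q : Fin m × Fin n with q.1 = s, e q.1 q.2 ω • u q.1 q.2 ω =
      ∑ i, e s i ω • u s i ω := by
    intro s ω
    rw [Finset.sum_filter, Fintype.sum_prod_type]
    simp [Finset.sum_ite_irrel]
  simp only [hcard, hsum, ← Finset.sum_div] at hmom
  set Y : Ω → ℝ := fun ω => ∑ s, ‖∑ i, e s i ω • u s i ω‖ ^ 2
  set B : ℝ := v * n * (m + 2 * L + 2 * √(m * L))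
  set D : ℝ := 2 * v * (n * r + n)
  have hD : 0 < D := by positivity
  have hem : ∀ s i, Measurable (e s i) := fun s i => (he s i).mono (𝓕.le _) le_rfl
  have hum : ∀ s i, Measurable (u s i) := fun s i => (hu s i).mono (𝓕.le _) le_rfl
  have hY : Measurable Y := by fun_prop
  have hE0 : ENNReal.ofReal (Real.exp (B / D)) ≠ 0 := by
    simp [Real.exp_pos]
  have hmarkov := mul_meas_ge_le_lintegral (μ := μ)
    (f := fun ω => ENNReal.ofReal (Real.exp (Y ω / D))) (by fun_prop)
    (ENNReal.ofReal (Real.exp (B / D)))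
  have hprod : ∏ _s : Fin m, √(((n : ℝ) * r + n) / (n * r)) =
      Real.exp (m / 2 * Real.log ((r + 1) / r)) := by
    have h1 : ((n : ℝ) * r + n) / (n * r) = (r + 1) / r := by field_simp
    have h2 : 0 < (r + 1) / r := by positivity
    rw [Finset.prod_const, Finset.card_univ, Fintype.card_fin, h1, Real.sqrt_eq_rpow,
      Real.rpow_def_of_pos h2, ← Real.exp_nat_mul]
    congr 1
    ring
  have hBD : B / D = (m + 2 * L + 2 * √(m * L)) / (2 * (r + 1)) := by
    simp only [B, D]
    field_simp
  have hset : {ω | B ≤ Y ω} ⊆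
      {ω | ENNReal.ofReal (Real.exp (B / D)) ≤ ENNReal.ofReal (Real.exp (Y ω / D))} := by
    intro ω hω
    have : B ≤ Y ω := hω
    exact ENNReal.ofReal_le_ofReal (Real.exp_le_exp.mpr (by gcongr))
  calc μ {ω | B ≤ Y ω}
      ≤ _ := measure_mono hset
    _ ≤ ENNReal.ofReal (Real.exp (m / 2 * Real.log ((r + 1) / r))) /
          ENNReal.ofReal (Real.exp (B / D)) := by
        rw [ENNReal.le_div_iff_mul_le (Or.inl hE0) (Or.inl ENNReal.ofReal_ne_top), mul_comm]
        exact hmarkov.trans (hprod ▸ hmom)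
    _ ≤ _ := by
        rw [← ENNReal.ofReal_div_of_pos (Real.exp_pos _), ← Real.exp_sub, hBD]
        exact ENNReal.ofReal_le_ofReal (Real.exp_le_exp.mpr hrL)

end Concentration

/-! ### The thresholds and the noise event -/

section Constants

variable {σ κ δ lam : ℝ} {m n p D S : ℕ}

lemma log_two_mul_div_pos (hp : 0 < p) (hδ : 0 < δ) (hδ1 : δ ≤ 1) :
    0 < Real.log (2 * p / δ) := by
  have hp' : (1 : ℝ) ≤ p := by exact_mod_cast hp
  refine Real.log_pos ?_
  rw [lt_div_iff₀ hδ]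
  linarith

lemma noiseFactor_pos (hδ : 0 < δ) (hδ1 : δ ≤ 1) : 0 < noiseFactor m p D δ := by
  -- for `p = 0` the logarithm is `log 0 = 0`
  have hL : 0 ≤ Real.log (2 * p / δ) := by
    rcases Nat.eq_zero_or_pos p with rfl | hp
    · simp
    · exact (log_two_mul_div_pos hp hδ hδ1).le
  refine Real.sqrt_pos.mpr ?_
  positivity

lemma lambdaThreshold_pos (hσ : 0 < σ) (hmn : 0 < (m : ℝ) * n) (hδ : 0 < δ) (hδ1 : δ ≤ 1) :
    0 < lambdaThreshold σ m n p D δ :=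
  mul_pos (div_pos (by positivity) (Real.sqrt_pos.mpr hmn)) (noiseFactor_pos hδ hδ1)

lemma recoveryError_eq (hκ : 0 < κ) :
    recoveryError σ κ S m n p D δ = 8 * S / κ ^ 2 * lambdaThreshold σ m n p D δ := by
  simp only [recoveryError, lambdaThreshold]
  field_simp
  ring

lemma div_lambdaThreshold_mul_recoveryError (hσ : 0 < σ) (hmn : 0 < (m : ℝ) * n) (hδ : 0 < δ)
    (hδ1 : δ ≤ 1) (hκ : 0 < κ) :
    lam / lambdaThreshold σ m n p D δ * recoveryError σ κ S m n p D δ = 8 * lam * S / κ ^ 2 := by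
  have h := (lambdaThreshold_pos (p := p) (D := D) hσ hmn hδ hδ1).ne'
  rw [recoveryError_eq hκ]
  field_simp

lemma sq_lambdaThreshold_ge (hσ : 0 < σ) (hm : 0 < m) (hn : 0 < n) (hp : 0 < p) (hD : 0 < D)
    (hδ : 0 < δ) (hδ1 : δ ≤ 1) :
    σ ^ 2 * n * (m + 2 * Real.log (2 * p / δ) + 2 * √(m * Real.log (2 * p / δ))) ≤
      ((m : ℝ) * n * lambdaThreshold σ m n p D δ / 4) ^ 2 := by
  have hL := log_two_mul_div_pos hp hδ hδ1
  simp only [lambdaThreshold, noiseFactor]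
  set L := Real.log (2 * p / δ)
  have hm' : (0 : ℝ) < m := Nat.cast_pos.mpr hm
  have hn' : (0 : ℝ) < n := Nat.cast_pos.mpr hn
  have hD' : (1 : ℝ) ≤ D := by exact_mod_cast hD
  have h1 : √(m * L) ≤ √((m : ℝ) * D * L) := by
    apply Real.sqrt_le_sqrt
    gcongr
    exact le_mul_of_one_le_right hm'.le hD'
  calc σ ^ 2 * n * (m + 2 * L + 2 * √(m * L))
      ≤ σ ^ 2 * n * (m + 2 * L + 2 * √((m : ℝ) * D * L)) := by gcongr
    _ = _ := by
      have h2 : (m : ℝ) * n * (4 * σ / √((m : ℝ) * n) *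
          √(1 + 2 / (m : ℝ) * (L + √((m : ℝ) * D * L)))) / 4 =
            σ * √((m : ℝ) * n) * √(1 + 2 / (m : ℝ) * (L + √((m : ℝ) * D * L))) := by
        have h3 := Real.mul_self_sqrt (show 0 ≤ (m : ℝ) * n by positivity)
        have h4 : √((m : ℝ) * n) ≠ 0 := (Real.sqrt_pos.mpr (by positivity)).ne'
        set R := √((m : ℝ) * n)
        rw [← h3]
        field_simp
      rw [h2, mul_pow, mul_pow, Real.sq_sqrt (by positivity), Real.sq_sqrt (by positivity)]
      field_simp
      ring

end Constants

section NoiseEvent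

open scoped ENNReal NNReal

variable {Ω : Type*} [mΩ : MeasurableSpace Ω] {μ : Measure Ω} [IsProbabilityMeasure μ]
  {X : Type*} [TopologicalSpace X] [MeasurableSpace X] [BorelSpace X]
  {m n p : ℕ} {d : Fin p → ℕ} {φ : (j : Fin p) → X → EuclideanSpace ℝ (Fin (d j))}
  {x : Fin m → Fin n → Ω → X} {noise : Fin m → Fin n → Ω → ℝ} {σ δ lam : ℝ}

/-- With probability at least `1 - δ / (2p)`, the correlation of the noise with the base kernel `j` is
dominated by the regularization. -/
lemma measure_noiseCorrelation_gt_le (hφ : ∀ j, Continuous (φ j))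
    (hk : ∀ j x x', baseKernel φ j x x' ≤ 1) (hm : 0 < m) (hn : 0 < n) (hσ : 0 < σ)
    (hnoise : IsSubgaussianNoise μ noise σ) (hna : IsNonanticipating μ x noise)
    (hδ : 0 < δ) (hδ1 : δ ≤ 1)
    (hlam : lambdaThreshold σ m n p (Finset.univ.sup d) δ ≤ lam) (j : Fin p) :
    μ {ω | (m : ℝ) * n * lam / 4 <
      groupNorm (noiseCorrelation φ (fun s i => x s i ω) fun s i => noise s i ω) j} ≤
        ENNReal.ofReal (δ / (2 * p)) := by
  have hmn : 0 < (m : ℝ) * n := mul_pos (Nat.cast_pos.mpr hm) (Nat.cast_pos.mpr hn)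
  have hlam0 : 0 < lam := (lambdaThreshold_pos hσ hmn hδ hδ1).trans_le hlam
  have hp : 0 < p := j.pos
  rcases Nat.eq_zero_or_pos (d j) with hd | hd
  · -- there is no correlation with an empty feature map
    have hsub : Subsingleton (EuclideanSpace ℝ (Fin (d j))) := by
      have : IsEmpty (Fin (d j)) := by rw [hd]; infer_instance
      exact ⟨fun a b => by ext i; exact isEmptyElim i⟩
    have hempty : {ω | (m : ℝ) * n * lam / 4 <
        groupNorm (noiseCorrelation φ (fun s i => x s i ω) fun s i => noise s i ω) j} = ∅ := by
      refine Set.eq_empty_of_forall_notMem fun ω hω => ?_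
      have h0 : groupNorm (noiseCorrelation φ (fun s i => x s i ω) fun s i => noise s i ω) j = 0 := by
        simp [groupNorm, Subsingleton.elim _ (0 : EuclideanSpace ℝ (Fin (d j)))]
      have h1 : (m : ℝ) * n * lam / 4 < 0 := h0 ▸ hω
      have : 0 < (m : ℝ) * n * lam / 4 := by positivity
      linarith
    rw [hempty, measure_empty]
    exact zero_le
  have hD : 0 < Finset.univ.sup d := hd.trans_le (Finset.le_sup (Finset.mem_univ j))
  obtain ⟨𝓕, τ, hτ, hx, he, hind⟩ := hna
  have hv : 0 < (σ ^ 2).toNNReal := Real.toNNReal_pos.mpr (by positivity)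
  have hvc : (((σ ^ 2).toNNReal : ℝ≥0) : ℝ) = σ ^ 2 := Real.coe_toNNReal _ (sq_nonneg σ)
  have htail := measure_sum_norm_sq_ge_le (μ := μ) (u := fun s i ω => φ j (x s i ω)) hm hn hτ
    (fun s i => (hφ j).measurable.comp (hx s i)) he hind hnoise.subgaussian hv
    (fun s i ω => by
      have := hk j (x s i ω) (x s i ω)
      rw [baseKernel, real_inner_self_eq_norm_sq] at this
      exact (sq_le_one_iff₀ (norm_nonneg _)).mp this)
    (log_two_mul_div_pos hp hδ hδ1)
  have hexp : Real.exp (-Real.log (2 * p / δ)) = δ / (2 * p) := by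
    have : (0 : ℝ) < p := Nat.cast_pos.mpr hp
    rw [Real.exp_neg, Real.exp_log (by positivity), inv_div]
  rw [hvc, hexp] at htail
  refine (measure_mono fun ω hω => ?_).trans htail
  have hω' : (m : ℝ) * n * lam / 4 <
      groupNorm (noiseCorrelation φ (fun s i => x s i ω) fun s i => noise s i ω) j := hω
  have h1 := sq_lambdaThreshold_ge hσ hm hn hp hD hδ hδ1
  have h0 := lambdaThreshold_pos (p := p) (D := Finset.univ.sup d) hσ hmn hδ hδ1
  refine h1.trans ?_
  have h2 : (m : ℝ) * n * lambdaThreshold σ m n p (Finset.univ.sup d) δ / 4 ≤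
      groupNorm (noiseCorrelation φ (fun s i => x s i ω) fun s i => noise s i ω) j :=
    le_trans (by gcongr) hω'.le
  refine (pow_le_pow_left₀ (by positivity) h2 2).trans_eq ?_
  rw [groupNorm_sq]
  rfl

/-- With probability greater than `1 - δ`, the regularization dominates the noise in all groups. -/
lemma exists_event_noiseCorrelation_le (hφ : ∀ j, Continuous (φ j)) (hk : ∀ j x x', baseKernel φ j x x' ≤ 1)
    (hm : 0 < m) (hn : 0 < n) (hσ : 0 < σ) (hnoise : IsSubgaussianNoise μ noise σ)
    (hna : IsNonanticipating μ x noise) (hδ : 0 < δ) (hδ1 : δ ≤ 1)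
    (hlam : lambdaThreshold σ m n p (Finset.univ.sup d) δ ≤ lam) {P : Ω → Prop}
    (hP : ∀ᵐ ω ∂μ, P ω) :
    ∃ E : Set Ω, MeasurableSet E ∧ ENNReal.ofReal (1 - δ) < μ E ∧ ∀ ω ∈ E, P ω ∧
      ∀ j, groupNorm (noiseCorrelation φ (fun s i => x s i ω) fun s i => noise s i ω) j ≤
        (m : ℝ) * n * lam / 4 := by
  set bad : Fin p → Set Ω := fun j => {ω | (m : ℝ) * n * lam / 4 <
    groupNorm (noiseCorrelation φ (fun s i => x s i ω) fun s i => noise s i ω) j}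
  set F : Set Ω := {ω | ¬ P ω} ∪ ⋃ j, bad j
  have hF : μ F ≤ ENNReal.ofReal (δ / 2) := by
    refine (measure_union_le _ _).trans ?_
    rw [ae_iff.mp hP, zero_add]
    refine (measure_iUnion_fintype_le μ _).trans ?_
    refine (Finset.sum_le_sum fun j _ =>
      measure_noiseCorrelation_gt_le hφ hk hm hn hσ hnoise hna hδ hδ1 hlam j).trans ?_
    rw [Finset.sum_const, Finset.card_univ, Fintype.card_fin, nsmul_eq_mul,
      ← ENNReal.ofReal_natCast, ← ENNReal.ofReal_mul (Nat.cast_nonneg p)]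
    apply ENNReal.ofReal_le_ofReal
    rcases Nat.eq_zero_or_pos p with rfl | hp
    · rw [Nat.cast_zero, zero_mul]
      positivity
    · have : (0 : ℝ) < p := Nat.cast_pos.mpr hp
      refine le_of_eq ?_
      field_simp
  refine ⟨(toMeasurable μ F)ᶜ, (measurableSet_toMeasurable μ F).compl, ?_, fun ω hω => ?_⟩
  · rw [prob_compl_eq_one_sub (measurableSet_toMeasurable μ F), measure_toMeasurable]
    calc ENNReal.ofReal (1 - δ) < ENNReal.ofReal (1 - δ / 2) :=
          (ENNReal.ofReal_lt_ofReal_iff (by linarith)).mpr (by linarith)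
      _ = 1 - ENNReal.ofReal (δ / 2) := by
          rw [ENNReal.ofReal_sub _ (by positivity), ENNReal.ofReal_one]
      _ ≤ 1 - μ F := tsub_le_tsub_left hF 1
  · have hωF : ω ∉ F := fun h => hω (subset_toMeasurable μ F h)
    simp only [F, Set.mem_union, Set.mem_iUnion, not_or, not_exists] at hωF
    exact ⟨not_not.mp hωF.1, fun j => not_lt.mp (hωF.2 j)⟩

end NoiseEvent

end MetaKeL

theorem mainTheorem1 (c₁ : ℝ) (hc₁ : 0 < c₁) :
    -- the remainder `o(ε)`; it depends on `c₁` only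
    ∃ r : ℝ → ℝ, r =o[𝓝[>] (0 : ℝ)] (fun e : ℝ => e) ∧
    ∀ (Ω : Type*) [MeasurableSpace Ω] (μ : Measure Ω) [IsProbabilityMeasure μ]
      -- the compact domain, the feature maps, and the true kernel
      (d₀ : ℕ) (𝒳 : Set (EuclideanSpace ℝ (Fin d₀))) (_ : IsCompact 𝒳)
      (p : ℕ) (d : Fin p → ℕ) (φ : (j : Fin p) → 𝒳 → EuclideanSpace ℝ (Fin (d j)))
      (_ : ∀ j, Continuous (φ j)) (_ : ∀ j x x', MetaKeL.baseKernel φ j x x' ≤ 1)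
      (ηstar : Fin p → ℝ) (_ : ∀ j, 0 ≤ ηstar j) (_ : ∑ j, |ηstar j| ≤ 1)
      -- the meta-data: `m` tasks with `n` noisy observations each
      (m n : ℕ) (_ : 0 < m) (_ : 0 < n)
      (f : Fin m → 𝒳 → ℝ) (βstar : MetaKeL.Coeff m d)
      (_ : ∀ s x, f s x = ∑ j, √(ηstar j) * inner ℝ (φ j x) (βstar s j))
      (x : Fin m → Fin n → Ω → 𝒳) (noise y : Fin m → Fin n → Ω → ℝ)
      (σ : ℝ) (_ : 0 < σ) (_ : MetaKeL.IsSubgaussianNoise μ noise σ)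
      (_ : MetaKeL.IsNonanticipating μ x noise)
      (_ : ∀ s i ω, y s i ω = f s (x s i ω) + noise s i ω)
      -- group beta-min condition, for the coefficients `√(η*_j) β*^{(j)}` of the regression on the `φ_j`
      (_ : ∀ j ∈ MetaKeL.activeSet ηstar,
        c₁ ≤ MetaKeL.groupNorm (fun s j => √(ηstar j) • βstar s j : MetaKeL.Coeff m d) j)
      -- sparsity and relaxed sufficient exploration
      (S : ℕ) (_ : (MetaKeL.activeSet ηstar).card ≤ S)
      (κ : ℝ) (_ : 0 < κ)
      (_ : ∀ᵐ ω ∂μ, MetaKeL.RelaxedSufficientExploration φ (fun s i => x s i ω) S κ)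
      -- confidence level, regularization parameter, and size of the error
      (δ : ℝ) (_ : 0 < δ) (_ : δ ≤ 1)
      (lam : ℝ) (_ : MetaKeL.lambdaThreshold σ m n p (Finset.univ.sup d) δ ≤ lam)
      (err : ℝ) (_ : err = lam / MetaKeL.lambdaThreshold σ m n p (Finset.univ.sup d) δ *
        MetaKeL.recoveryError σ κ S m n p (Finset.univ.sup d) δ)
      (_ : err ≤ c₁),
      ∃ E : Set Ω, MeasurableSet E ∧ ENNReal.ofReal (1 - δ) < μ E ∧ ∀ ω ∈ E,
        -- for all weights that are learned from the data by Meta-KeL or by the group Lasso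
        ∀ ηhat : Fin p → ℝ,
          ((∃ fhat : Fin m → 𝒳 → ℝ, MetaKeL.IsMetaKeLSolution φ (fun s i => x s i ω)
              (fun s i => y s i ω) lam ηhat fhat) ∨
            (∃ βhat : MetaKeL.Coeff m d, MetaKeL.IsGroupLassoSolution φ (fun s i => x s i ω)
              (fun s i => y s i ω) lam βhat ∧ ∀ j, ηhat j = MetaKeL.groupNorm βhat j)) →
          MetaKeL.rkhs (MetaKeL.combKernel φ ηstar) ⊆
              MetaKeL.rkhs (MetaKeL.combKernel φ fun j => ηhat j / c₁) ∧
            ∀ g ∈ MetaKeL.rkhs (MetaKeL.combKernel φ ηstar),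
              MetaKeL.rkhsNorm (MetaKeL.combKernel φ fun j => ηhat j / c₁) g ≤
                MetaKeL.rkhsNorm (MetaKeL.combKernel φ ηstar) g * (1 + err / (2 * c₁) + r err) := by
  -- the weights are learned with an error of at most `3 err / 16`, so that no remainder is needed
  refine ⟨fun _ => 0, isLittleO_zero _ _, ?_⟩
  intro Ω _ μ _ d₀ 𝒳 _ p d φ hφ hk ηstar hη hη1 m n hm hn f βstar hf x noise y σ hσ hnoise hna hy
    hmin S hS κ hκ hRSE δ hδ hδ1 lam hlam err herr herrc
  have hmn : 0 < (m : ℝ) * n := mul_pos (Nat.cast_pos.mpr hm) (Nat.cast_pos.mpr hn)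
  have hlam0 : 0 < lam := (MetaKeL.lambdaThreshold_pos hσ hmn hδ hδ1).trans_le hlam
  rw [MetaKeL.div_lambdaThreshold_mul_recoveryError hσ hmn hδ hδ1 hκ] at herr
  have herr0 : 0 ≤ err := by
    rw [herr]
    positivity
  obtain ⟨E, hE, hμE, hgood⟩ :=
    MetaKeL.exists_event_noiseCorrelation_le hφ hk hm hn hσ hnoise hna hδ hδ1 hlam hRSE
  refine ⟨E, hE, hμE, fun ω hω ηhat hlearn => ?_⟩
  obtain ⟨hre, hcorr⟩ := hgood ω hω
  obtain ⟨b, hb, hηb⟩ : ∃ b : MetaKeL.Coeff m d, MetaKeL.IsGroupLassoSolution φ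
      (fun s i => x s i ω) (fun s i => y s i ω) lam b ∧ ∀ j, ηhat j = MetaKeL.groupNorm b j := by
    rcases hlearn with ⟨fhat, hsol⟩ | h
    · exact MetaKeL.exists_groupLassoSolution_of_metaKeL hlam0 hsol
    · exact h
  have hdata : ∀ s i, y s i ω = MetaKeL.design φ (fun s i => x s i ω)
      (fun s j => √(ηstar j) • βstar s j) s i + noise s i ω := by
    intro s i
    simp [hy, hf, MetaKeL.design, inner_smul_right]
  have hsupp : ∀ j ∉ MetaKeL.activeSet ηstar,
      MetaKeL.groupNorm (fun s j => √(ηstar j) • βstar s j : MetaKeL.Coeff m d) j = 0 := by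
    intro j hj
    have : ηstar j = 0 := by simpa [MetaKeL.activeSet] using hj
    simp [MetaKeL.groupNorm, this]
  have hweights : ∀ j ∈ MetaKeL.activeSet ηstar, 1 - 3 * (err / c₁) / 16 ≤ ηhat j / c₁ := by
    intro j hj
    rw [herr, hηb]
    exact MetaKeL.le_groupNorm_div_of_groupLasso hmn hlam0 hdata hcorr hsupp hS hκ hre hb hc₁
      hmin hj
  have hηhat : ∀ j, 0 ≤ ηhat j / c₁ := fun j =>
    div_nonneg (hηb j ▸ MetaKeL.groupNorm_nonneg b j) hc₁.le
  have hrec : ∀ g ∈ MetaKeL.rkhs (MetaKeL.combKernel φ ηstar), _ := fun g hg =>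
    MetaKeL.rkhs_recovery_of_weights hη hη1 hηhat (div_nonneg herr0 hc₁.le)
      ((div_le_one hc₁).mpr herrc) hweights hg
  refine ⟨fun g hg => (hrec g hg).1, fun g hg => (hrec g hg).2.trans_eq ?_⟩
  rw [add_zero, div_div, mul_comm c₁]
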